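/- **Theorem 3.1 (Delocalization theorem).** Let $0<y\le 1$ and $\varepsilon>0$, and put $a=(1-\sqrt y)^2$, $b=(1+\sqrt y)^2$. There is a constant $C>0$, depending only on $y$ and $\varepsilon$, such that the following holds. For each $n$ let $p=p(n)$ be a natural number with $p\le n$ for all large $n$ and $p/n\to y$ as $n\to\infty$, and let $M=M_n=(\zeta_{ij})_{1\le i\le p,\,1\le j\le n}$ be a random $p\times n$ complex matrix (whose distribution may depend on $n$) satisfying the following for all sufficiently large $n$: - (Condition **C1**) the entries $\zeta_{ij}$ are jointly independent, have mean zero and variance $\mathbf E|\zeta_{ij}|^2=1$, and $\sup_{i,j}\mathbf E|\zeta_{ij}|^{C_0}\le B$, where $C_0\ge 2$ and $B$ are independent of $n$; - $|\zeta_{ij}|\le K$ almost surely for all $i,j$, where $K=K(n)>1$ may depend on $n$; - the probability distribution of $M$ is continuous, i.e. $\mathbf P(M=A)=0$ for every fixed $p\times n$ matrix $A$. Then, with overwhelming probability, every unit right singular vector $u\in\mathbf C^n$ and every unit left singular vector $v\in\mathbf C^p$ of $M$ (that is, every unit eigenvector $u$ of $\frac1n M^*M$ and every unit eigenvector $v$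 of $\frac1n MM^*$) with eigenvalue in the interval $[a+\varepsilon,b-\varepsilon]$ has all its coefficients of absolute value at most $C K n^{-1/2}\log^{10} n$. Here "with overwhelming probability" means that for every $A>0$ the probability that the assertion fails is $O(n^{-A})$ as $n\to\infty$, where the implied constant may depend on $A$. -/

import Mathlib

open MeasureTheory ProbabilityTheory Filter Topology
open scoped Matrix

/-- Left edge `a = (1 - √y)²` of the Marchenko–Pastur law. -/
noncomputable def mpLeft (y : ℝ) : ℝ := (1 - Real.sqrt y) ^ 2

/-- Right edge `b = (1 + √y)²` of the Marchenko–Pastur law. -/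
noncomputable def mpRight (y : ℝ) : ℝ := (1 + Real.sqrt y) ^ 2

/-- Condition **C1** for one random `p × n` matrix, with exponent `C₀` and moment constant `B`.
The variance of a complex variable `ζ` is `𝔼 |ζ - 𝔼 ζ|²`. For a sequence of matrices, `C₀` and `B`
have to be the same for all members. -/
structure ConditionC1 {Ω : Type*} [MeasurableSpace Ω] (P : Measure Ω) {p n : ℕ}
    (M : Ω → Matrix (Fin p) (Fin n) ℂ) (C₀ B : ℝ) : Prop where
  measurable : ∀ i j, Measurable fun ω => M ω i j
  indep : iIndepFun (fun (ij : Fin p × Fin n) (ω : Ω) => M ω ij.1 ij.2) P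
  integrable : ∀ i j, Integrable (fun ω => M ω i j) P
  mean_zero : ∀ i j, ∫ ω, M ω i j ∂P = 0
  variance_one : ∀ i j, ∫ ω, ‖M ω i j - ∫ ω', M ω' i j ∂P‖ ^ 2 ∂P = 1
  moment_integrable : ∀ i j, Integrable (fun ω => ‖M ω i j‖ ^ C₀) P
  moment_le : ∀ i j, ∫ ω, ‖M ω i j‖ ^ C₀ ∂P ≤ B

/-- The distribution of the random matrix `M` is continuous: it has no atoms. -/
def HasContinuousLaw {Ω : Type*} [MeasurableSpace Ω] (P : Measure Ω) {p n : ℕ}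
    (M : Ω → Matrix (Fin p) (Fin n) ℂ) : Prop :=
  ∀ A : Matrix (Fin p) (Fin n) ℂ, P {ω | M ω = A} = 0

/-- The `n × n` covariance matrix `W = (1/n) M* M`. -/
noncomputable def covMatrix {p n : ℕ} (M : Matrix (Fin p) (Fin n) ℂ) :
    Matrix (Fin n) (Fin n) ℂ :=
  (1 / (n : ℂ)) • (Mᴴ * M)

/-- The `p × p` matrix `(1/n) M M*`. -/
noncomputable def covMatrixLeft {p n : ℕ} (M : Matrix (Fin p) (Fin n) ℂ) :
    Matrix (Fin p) (Fin p) ℂ :=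
  (1 / (n : ℂ)) • (M * Mᴴ)

/-- `u` is a right singular vector of `M` with eigenvalue `lam` (singular value `√n * √lam`):
an eigenvector of `(1/n) M* M` with eigenvalue `lam`. -/
def IsRightSingularVector {p n : ℕ} (M : Matrix (Fin p) (Fin n) ℂ) (lam : ℝ)
    (u : EuclideanSpace ℂ (Fin n)) : Prop :=
  Module.End.HasEigenvector (Matrix.toEuclideanLin (covMatrix M)) (lam : ℂ) u

/-- `v` is a left singular vector of `M` with eigenvalue `lam` (singular value `√n * √lam`):
an eigenvector of `(1/n) M M*` with eigenvalue `lam`. -/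
def IsLeftSingularVector {p n : ℕ} (M : Matrix (Fin p) (Fin n) ℂ) (lam : ℝ)
    (v : EuclideanSpace ℂ (Fin p)) : Prop :=
  Module.End.HasEigenvector (Matrix.toEuclideanLin (covMatrixLeft M)) (lam : ℂ) v

/-- All unit left and right singular vectors of `M` whose eigenvalue lies in `I` have all
coefficients of modulus at most `R`. -/
def SingularVectorsBounded {p n : ℕ} (M : Matrix (Fin p) (Fin n) ℂ) (I : Set ℝ) (R : ℝ) : Prop :=
  ∀ lam ∈ I,
    (∀ u : EuclideanSpace ℂ (Fin n), ‖u‖ = 1 → IsRightSingularVector M lam u →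
      ∀ j, ‖u j‖ ≤ R) ∧
    (∀ v : EuclideanSpace ℂ (Fin p), ‖v‖ = 1 → IsLeftSingularVector M lam v →
      ∀ i, ‖v i‖ ≤ R)

/-- The events `E n` hold with overwhelming probability: for every `A > 0`, the probability that
`E n` fails is `O_A(n ^ (-A))`. -/
def WithOverwhelmingProbability {Ω : ℕ → Type*} [∀ n, MeasurableSpace (Ω n)]
    (P : ∀ n, Measure (Ω n)) (E : ∀ n, Set (Ω n)) : Prop :=
  ∀ A : ℝ, 0 < A → ∃ B : ℝ, ∀ᶠ n : ℕ in atTop,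
    P n (E n)ᶜ ≤ ENNReal.ofReal (B * (n : ℝ) ^ (-A))

/-!
The coordinates of unit eigenvectors are read off from resolvents. If `v` is a unit eigenvector of
a Gram matrix `H` with eigenvalue `λ` and `z = E + i η` with `|λ - E| ≤ η`, then `|v j|²` is at
most `2 η |G j j|`, where `G = (H - z)⁻¹` (`norm_sq_apply_le_of_eigenvector`). This needs no
simplicity of the spectrum. It therefore suffices to bound the diagonal entries of the resolvents
of `X Xᴴ` and `Xᴴ X`, for `X = M / √n`, at a scale `η` of order `K² log¹⁸ n / n` and for `E` in a
grid of mesh `1 / n` in the bulk. If `K² log²⁰ n ≥ n`, the claimed bound is at least `1` and there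
is nothing to prove.

By the Schur complement formula (`mul_gramResolvent_diag_mul`), `z G' i i (1 + q i) = -1` for the
resolvent `G'` of `X Xᴴ`, where `q i` is the quadratic form of the `i`-th row with the resolvent
of the matrix without this row. Row and minor are independent, so `q i` concentrates around
`tr G / n` (`IsBoundedStandard.measure_quadratic_gt_le`) with an error that the Ward identity and the
rank-one bound `norm_trace_gramResolvent_sub_le` express through `Im tr G / n`. The bound for
quadratic forms has the factor `K` at the Frobenius norm and `K²` only at the operator norm; this
is what permits scales as small as `K² / n` up to logarithms. It is obtained by sorting the pairs
of indices by their lowest differing binary digit, which yields bilinear forms in independent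
vectors.

Only a lower bound on `Im tr G' / p` is still needed, and no convergence to the Marchenko–Pastur
law. At `η = 1` it follows from the trace of `X Xᴴ`. Halving `η` loses at most a factor `2`. The
halved bound is enough for the concentration errors to be relatively small, so `tr G' / p` solves
the Marchenko–Pastur equation approximately; in the bulk this quadratic equation has negative
discriminant, which forces a fixed lower bound on the imaginary part
(`min_le_im_of_selfConsistent`) and thereby restores the lost factor
(`le_im_trace_gramResolvent_of_minorControl`).
-/

/-! ### Bernstein-type tail bounds and conditioning on an independent variable -/

/-- Bernstein's inequality at a single scale: if `T` bounds both the summands and the standard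
deviation of the sum, the exponential moment with parameter `1 / T` is at most `e`. -/
theorem measure_sum_gt_le_of_pos {Ω ι : Type*} [MeasurableSpace Ω] {P : Measure Ω}
    [IsProbabilityMeasure P] [Fintype ι] {Y : ι → Ω → ℝ} {T : ℝ}
    (hm : ∀ i, Measurable (Y i)) (hind : iIndepFun Y P)
    (hb : ∀ i, ∀ᵐ ω ∂P, |Y i ω| ≤ T) (hmean : ∀ i, ∫ ω, Y i ω ∂P = 0)
    (hvar : ∑ i, ∫ ω, Y i ω ^ 2 ∂P ≤ T ^ 2) (hT : 0 < T) (L : ℝ) :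
    P {ω | L * T < ∑ i, Y i ω} ≤ ENNReal.ofReal (Real.exp (1 - L)) := by
  have hbd : ∀ i, ∀ᵐ ω ∂P, |T⁻¹ * Y i ω| ≤ 1 := fun i => by
    filter_upwards [hb i] with ω hω
    rw [abs_mul, abs_of_pos (inv_pos.2 hT), inv_mul_le_iff₀ hT, mul_one]
    exact hω
  have hYi : ∀ i, Integrable (Y i) P := fun i =>
    Integrable.of_bound (hm i).aestronglyMeasurable T (hb i)
  have hY2 : ∀ i, Integrable (fun ω => Y i ω ^ 2) P := fun i =>
    Integrable.of_bound ((hm i).pow_const 2).aestronglyMeasurable (T ^ 2) (by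
      filter_upwards [hb i] with ω hω
      rw [Real.norm_eq_abs, abs_pow]
      exact pow_le_pow_left₀ (abs_nonneg _) hω 2)
  have hexp : ∀ i, Integrable (fun ω => Real.exp (T⁻¹ * Y i ω)) P := fun i =>
    Integrable.of_bound (by have := hm i; fun_prop) (Real.exp 1) (by
      filter_upwards [hbd i] with ω hω
      rw [Real.norm_eq_abs, Real.abs_exp]
      exact Real.exp_le_exp.2 ((le_abs_self _).trans hω))
  have hmgf : ∀ i, mgf (Y i) P T⁻¹ ≤ Real.exp (T⁻¹ ^ 2 * ∫ ω, Y i ω ^ 2 ∂P) := fun i => by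
    have h1 : mgf (Y i) P T⁻¹ ≤ ∫ ω, (1 + T⁻¹ * Y i ω + T⁻¹ ^ 2 * Y i ω ^ 2) ∂P := by
      refine integral_mono_ae (hexp i)
        (((integrable_const _).add ((hYi i).const_mul _)).add ((hY2 i).const_mul _)) ?_
      filter_upwards [hbd i] with ω hω
      have := Real.abs_exp_sub_one_sub_id_le hω
      have := (le_abs_self _).trans this
      have h3 : Real.exp (T⁻¹ * Y i ω) - 1 - T⁻¹ * Y i ω ≤ T⁻¹ ^ 2 * Y i ω ^ 2 := by
        rw [← mul_pow]; exact this
      linarith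
    have h2 : ∫ ω, (1 + T⁻¹ * Y i ω + T⁻¹ ^ 2 * Y i ω ^ 2) ∂P
        = 1 + T⁻¹ ^ 2 * ∫ ω, Y i ω ^ 2 ∂P := by
      rw [integral_add (f := fun ω => 1 + T⁻¹ * Y i ω) (g := fun ω => T⁻¹ ^ 2 * Y i ω ^ 2)
          ((integrable_const _).add ((hYi i).const_mul _)) ((hY2 i).const_mul _),
        integral_add (integrable_const _) ((hYi i).const_mul _), integral_const_mul,
        integral_const_mul, hmean i]
      simp
    rw [h2] at h1
    linarith [Real.add_one_le_exp (T⁻¹ ^ 2 * ∫ ω, Y i ω ^ 2 ∂P)]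
  have hprod : mgf (∑ i, Y i) P T⁻¹ ≤ Real.exp 1 := by
    rw [hind.mgf_sum hm]
    calc ∏ i, mgf (Y i) P T⁻¹ ≤ ∏ i, Real.exp (T⁻¹ ^ 2 * ∫ ω, Y i ω ^ 2 ∂P) :=
          Finset.prod_le_prod (fun i _ => mgf_nonneg) fun i _ => hmgf i
      _ = Real.exp (T⁻¹ ^ 2 * ∑ i, ∫ ω, Y i ω ^ 2 ∂P) := by
          rw [← Real.exp_sum, Finset.mul_sum]
      _ ≤ Real.exp 1 := by
          refine Real.exp_le_exp.2 ?_
          calc T⁻¹ ^ 2 * ∑ i, ∫ ω, Y i ω ^ 2 ∂P ≤ T⁻¹ ^ 2 * T ^ 2 := by gcongr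
            _ = 1 := by field_simp
  have hint : Integrable (fun ω => Real.exp (T⁻¹ * (∑ i, Y i) ω)) P := by
    have := hind.integrable_exp_mul_sum (t := T⁻¹) (s := Finset.univ) hm fun i _ => hexp i
    exact this
  have hch := measure_ge_le_exp_mul_mgf (L * T) (inv_nonneg.2 hT.le) hint
  have hfin : P.real {ω | L * T ≤ (∑ i, Y i) ω} ≤ Real.exp (1 - L) := by
    refine hch.trans ?_
    calc Real.exp (-T⁻¹ * (L * T)) * mgf (∑ i, Y i) P T⁻¹
        ≤ Real.exp (-T⁻¹ * (L * T)) * Real.exp 1 := by gcongr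
      _ = Real.exp (1 - L) := by
          rw [← Real.exp_add]; congr 1; field_simp; ring
  calc P {ω | L * T < ∑ i, Y i ω} ≤ P {ω | L * T ≤ (∑ i, Y i) ω} := by
        refine measure_mono fun ω hω => ?_
        simp only [Set.mem_ofPred_eq, Finset.sum_apply] at hω ⊢
        exact hω.le
    _ ≤ _ := by
        rw [← ofReal_measureReal]
        exact ENNReal.ofReal_le_ofReal hfin

theorem measure_abs_sum_gt_le {Ω ι : Type*} [MeasurableSpace Ω] {P : Measure Ω}
    [IsProbabilityMeasure P] [Fintype ι] {Y : ι → Ω → ℝ} {T : ℝ}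
    (hm : ∀ i, Measurable (Y i)) (hind : iIndepFun Y P)
    (hb : ∀ i, ∀ᵐ ω ∂P, |Y i ω| ≤ T) (hmean : ∀ i, ∫ ω, Y i ω ∂P = 0)
    (hvar : ∑ i, ∫ ω, Y i ω ^ 2 ∂P ≤ T ^ 2) (hT : 0 ≤ T) (L : ℝ) :
    P {ω | L * T < |∑ i, Y i ω|} ≤ 2 * ENNReal.ofReal (Real.exp (1 - L)) := by
  rcases hT.eq_or_lt with rfl | hT
  · have h0 : ∀ᵐ ω ∂P, ¬ (L * 0 < |∑ i, Y i ω|) := by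
      filter_upwards [ae_all_iff.2 hb] with ω hω
      have : ∑ i, Y i ω = 0 := Finset.sum_eq_zero fun i _ => abs_nonpos_iff.1 (hω i)
      simp [this]
    have := ae_iff.1 h0
    simp only [not_not] at this
    rw [this]; exact bot_le
  · have h1 := measure_sum_gt_le_of_pos hm hind hb hmean hvar hT L
    have h2 := measure_sum_gt_le_of_pos (Y := fun i ω => - Y i ω) (fun i => (hm i).neg)
      (hind.comp (fun _ x => -x) fun _ => measurable_neg) (by simpa using hb)
      (fun i => by rw [integral_neg, hmean i, neg_zero]) (by simpa using hvar) hT L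
    calc P {ω | L * T < |∑ i, Y i ω|}
        ≤ P ({ω | L * T < ∑ i, Y i ω} ∪ {ω | L * T < ∑ i, - Y i ω}) := by
          refine measure_mono fun ω hω => ?_
          simp only [Set.mem_ofPred_eq, Set.mem_union, Finset.sum_neg_distrib] at hω ⊢
          exact lt_abs.1 hω
      _ ≤ _ := (measure_union_le _ _).trans (by rw [two_mul]; exact add_le_add h1 h2)

/-- The scale `T = 0` is allowed, since then the sum vanishes almost surely. -/
theorem measure_norm_sum_gt_le {Ω ι : Type*} [MeasurableSpace Ω] {P : Measure Ω}
    [IsProbabilityMeasure P] [Fintype ι] {Z : ι → Ω → ℂ} {T : ℝ}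
    (hm : ∀ i, Measurable (Z i)) (hind : iIndepFun Z P)
    (hb : ∀ i, ∀ᵐ ω ∂P, ‖Z i ω‖ ≤ T) (hmean : ∀ i, ∫ ω, Z i ω ∂P = 0)
    (hvar : ∑ i, ∫ ω, ‖Z i ω‖ ^ 2 ∂P ≤ T ^ 2) (hT : 0 ≤ T) (L : ℝ) :
    P {ω | 2 * L * T < ‖∑ i, Z i ω‖} ≤ 4 * ENNReal.ofReal (Real.exp (1 - L)) := by
  have hZi : ∀ i, Integrable (Z i) P := fun i =>
    Integrable.of_bound (hm i).aestronglyMeasurable T (hb i)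
  have hZ2 : ∀ i, Integrable (fun ω => ‖Z i ω‖ ^ 2) P := fun i =>
    Integrable.of_bound ((hm i).norm.pow_const 2).aestronglyMeasurable (T ^ 2) (by
      filter_upwards [hb i] with ω hω
      rw [norm_pow, norm_norm]
      exact pow_le_pow_left₀ (norm_nonneg _) hω 2)
  -- the real part and the imaginary part are treated alike
  have key : ∀ f : ℂ → ℝ, Measurable f → (∀ w, |f w| ≤ ‖w‖) →
      (∀ i, ∫ ω, f (Z i ω) ∂P = 0) →
      P {ω | L * T < |∑ i, f (Z i ω)|} ≤ 2 * ENNReal.ofReal (Real.exp (1 - L)) := by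
    intro f hf hfn hf0
    refine measure_abs_sum_gt_le (Y := fun i ω => f (Z i ω)) (fun i => hf.comp (hm i))
      (hind.comp (fun _ => f) fun _ => hf) (fun i => ?_) hf0 (le_trans ?_ hvar) hT L
    · filter_upwards [hb i] with ω hω using (hfn _).trans hω
    · refine Finset.sum_le_sum fun i _ => ?_
      refine integral_mono_of_nonneg (ae_of_all _ fun ω => sq_nonneg _) (hZ2 i)
        (ae_of_all _ fun ω => ?_)
      simp only
      rw [← sq_abs]
      exact pow_le_pow_left₀ (abs_nonneg _) (hfn _) 2
  have h1 := key Complex.re Complex.measurable_re Complex.abs_re_le_norm fun i => by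
    have := integral_re (𝕜 := ℂ) (hZi i)
    simpa [hmean i] using this
  have h2 := key Complex.im Complex.measurable_im Complex.abs_im_le_norm fun i => by
    have := integral_im (𝕜 := ℂ) (hZi i)
    simpa [hmean i] using this
  calc P {ω | 2 * L * T < ‖∑ i, Z i ω‖}
      ≤ P ({ω | L * T < |∑ i, (Z i ω).re|} ∪ {ω | L * T < |∑ i, (Z i ω).im|}) := by
        refine measure_mono fun ω hω => ?_
        simp only [Set.mem_ofPred_eq, Set.mem_union] at hω ⊢
        by_contra! h
        have := Complex.norm_le_abs_re_add_abs_im (∑ i, Z i ω)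
        rw [Complex.re_sum, Complex.im_sum] at this
        linarith [h.1, h.2]
    _ ≤ _ := (measure_union_le _ _).trans ((add_le_add h1 h2).trans_eq (by ring))

/-- A bound on the probability of an event about `(X, Y)` that holds for every frozen value of `Y`
persists when `Y` is random and independent of `X`. -/
theorem measure_indepFun_le {Ω α β : Type*} [MeasurableSpace Ω] [MeasurableSpace α]
    [MeasurableSpace β] {P : Measure Ω} [IsProbabilityMeasure P] {X : Ω → α} {Y : Ω → β}
    (hX : Measurable X) (hY : Measurable Y) (hXY : IndepFun X Y P) {S : Set (α × β)}
    (hS : MeasurableSet S) {δ : ENNReal} (h : ∀ y, P {ω | (X ω, y) ∈ S} ≤ δ) :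
    P {ω | (X ω, Y ω) ∈ S} ≤ δ := by
  have h1 : P {ω | (X ω, Y ω) ∈ S} = (P.map X).prod (P.map Y) S := by
    rw [← (indepFun_iff_map_prod_eq_prod_map_map hX.aemeasurable hY.aemeasurable).1 hXY,
      Measure.map_apply (hX.prodMk hY) hS]
    rfl
  have : IsProbabilityMeasure (P.map X) := Measure.isProbabilityMeasure_map hX.aemeasurable
  have : IsProbabilityMeasure (P.map Y) := Measure.isProbabilityMeasure_map hY.aemeasurable
  rw [h1, Measure.prod_apply_symm hS]
  calc ∫⁻ y, (P.map X) ((fun x => (x, y)) ⁻¹' S) ∂(P.map Y)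
      ≤ ∫⁻ _, δ ∂(P.map Y) := by
        refine lintegral_mono fun y => ?_
        rw [Measure.map_apply hX (measurable_prodMk_right hS)]
        exact h y
    _ = δ := by simp

/-! ### Bilinear and diagonal forms in bounded standard variables -/

/-- An independent family of complex variables with mean zero and `𝔼 |x i|² = 1`, bounded by `K`
almost surely. -/
structure IsBoundedStandard {Ω ι : Type*} [MeasurableSpace Ω] (P : Measure Ω)
    (x : ι → Ω → ℂ) (K : ℝ) : Prop where
  measurable : ∀ i, Measurable (x i)
  indep : iIndepFun x P
  bound : ∀ i, ∀ᵐ ω ∂P, ‖x i ω‖ ≤ K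
  mean : ∀ i, ∫ ω, x i ω ∂P = 0
  second : ∀ i, ∫ ω, ‖x i ω‖ ^ 2 ∂P = 1

/-- Subfamilies over disjoint index sets are independent; each is extended by zero, so that both
remain indexed by `ι`. -/
theorem indepFun_ite_mem {Ω ι : Type*} [MeasurableSpace Ω] {P : Measure Ω} [Fintype ι]
    [DecidableEq ι] {x : ι → Ω → ℂ} (hm : ∀ i, Measurable (x i)) (hind : iIndepFun x P)
    {I J : Finset ι} (hIJ : Disjoint I J) :
    IndepFun (fun ω i => if i ∈ I then x i ω else 0) (fun ω j => if j ∈ J then x j ω else 0) P := by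
  have h := hind.indepFun_finset I J hIJ hm
  have hmeas : ∀ S : Finset ι,
      Measurable (fun (u : S → ℂ) (i : ι) => if h : i ∈ S then u ⟨i, h⟩ else 0) := fun S => by
    refine measurable_pi_lambda _ fun i => ?_
    by_cases hi : i ∈ S
    · simp only [hi, dite_true]; exact measurable_pi_apply _
    · simp only [hi, dite_false]; exact measurable_const
  have h2 := h.comp (hmeas I) (hmeas J)
  convert h2 using 1 <;> (funext ω i; simp)

theorem measurableSet_forall_and {α ι : Type*} [MeasurableSpace α] [Countable ι]
    {p : ι → α → Prop} {q : α → Prop} (hp : ∀ i, MeasurableSet {y | p i y})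
    (hq : MeasurableSet {y | q y}) : MeasurableSet {y | (∀ i, p i y) ∧ q y} := by
  have : {y | (∀ i, p i y) ∧ q y} = (⋂ i, {y | p i y}) ∩ {y | q y} := by
    ext y; simp
  rw [this]
  exact (MeasurableSet.iInter hp).inter hq

/-- Tail bound for a bilinear form whose coefficients are supported on a rectangle `I ×ˢ J` with
`I` and `J` disjoint. Bernstein's inequality is used twice: the linear forms in the variables of
`J` are at most `2 L K` times the norms of the rows of `a`; given these, the sum over `I` has
variance of order `K² F²` and summands of order `K² τ`. Using the variance in the second
application is what keeps the factor of the Frobenius norm `F` down to `K` instead of `K²`. -/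
theorem IsBoundedStandard.measure_bilinear_gt_le {Ω ι : Type*} [MeasurableSpace Ω]
    {P : Measure Ω} [IsProbabilityMeasure P] [Fintype ι] [DecidableEq ι] {x : ι → Ω → ℂ} {K : ℝ}
    (hx : IsBoundedStandard P x K) (hK : 1 ≤ K) {I J : Finset ι} (hIJ : Disjoint I J)
    {a : ι → ι → ℂ} (ha : ∀ i j, ¬ (i ∈ I ∧ j ∈ J) → a i j = 0) {τ F : ℝ} (hτ : 0 ≤ τ)
    (hF : 0 ≤ F) (hrow : ∀ i, ∑ j, ‖a i j‖ ^ 2 ≤ τ ^ 2) (hFro : ∑ i, ∑ j, ‖a i j‖ ^ 2 ≤ F ^ 2)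
    {L : ℝ} (hL : 0 ≤ L) :
    P {ω | 4 * L ^ 2 * (K * F + K ^ 2 * τ) <
        ‖∑ i, ∑ j, x i ω * a i j * (starRingEnd ℂ) (x j ω)‖} ≤
      (4 * (Fintype.card ι + 1)) * ENNReal.ofReal (Real.exp (1 - L)) := by
  have hK0 : 0 ≤ K := zero_le_one.trans hK
  set e := ENNReal.ofReal (Real.exp (1 - L)) with he
  set ρ : ι → ℝ := fun i => √(∑ j, ‖a i j‖ ^ 2) with hρ
  have hρ0 : ∀ i, 0 ≤ ρ i := fun i => Real.sqrt_nonneg _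
  have hρ2 : ∀ i, ρ i ^ 2 = ∑ j, ‖a i j‖ ^ 2 := fun i =>
    Real.sq_sqrt (Finset.sum_nonneg fun j _ => sq_nonneg _)
  have hρτ : ∀ i, ρ i ≤ τ := fun i => by
    rw [hρ]; exact Real.sqrt_le_iff.2 ⟨hτ, hrow i⟩
  have haρ : ∀ i j, ‖a i j‖ ≤ ρ i := fun i j => by
    refine Real.le_sqrt_of_sq_le ?_
    exact Finset.single_le_sum (f := fun j => ‖a i j‖ ^ 2) (fun j _ => sq_nonneg _)
      (Finset.mem_univ j)
  let b : ι → (ι → ℂ) → ℂ := fun i w => ∑ j, a i j * (starRingEnd ℂ) (w j)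
  have hbI : ∀ i w, i ∉ I → b i w = 0 := fun i w hi =>
    Finset.sum_eq_zero fun j _ => by rw [ha i j (fun h => hi h.1), zero_mul]
  have hbJ : ∀ i (w : ι → ℂ), b i (fun j => if j ∈ J then w j else 0) = b i w := fun i w => by
    refine Finset.sum_congr rfl fun j _ => ?_
    by_cases hj : j ∈ J
    · simp [hj]
    · rw [ha i j (fun h => hj h.2), zero_mul, zero_mul]
  have hbm : ∀ i, Measurable (b i) := fun i => by
    have : Continuous (b i) := by
      refine continuous_finsetSum _ fun j _ => ?_
      exact continuous_const.mul (Complex.continuous_conj.comp (continuous_apply j))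
    exact this.measurable
  -- the linear forms `b i` are controlled by their variance and the size of the entries
  have hlin : ∀ i, P {ω | 2 * L * (K * ρ i) < ‖b i (fun j => x j ω)‖} ≤ 4 * e := fun i => by
    refine measure_norm_sum_gt_le (Z := fun j ω => a i j * (starRingEnd ℂ) (x j ω))
      (fun j => (Complex.continuous_conj.measurable.comp (hx.measurable j)).const_mul _)
      (hx.indep.comp (fun j w => a i j * (starRingEnd ℂ) w)
        fun j => Complex.continuous_conj.measurable.const_mul _)
      (fun j => ?_) (fun j => ?_) ?_ (mul_nonneg hK0 (hρ0 i)) L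
    · filter_upwards [hx.bound j] with ω hω
      rw [norm_mul, RCLike.norm_conj, mul_comm]
      exact mul_le_mul hω (haρ i j) (norm_nonneg _) hK0
    · rw [integral_const_mul, integral_conj, hx.mean j]; simp
    · simp only [norm_mul, RCLike.norm_conj, mul_pow, integral_const_mul, hx.second, mul_one]
      rw [← hρ2]
      have : 1 ≤ K ^ 2 := one_le_pow₀ hK
      nlinarith [sq_nonneg (ρ i)]
  set T : ℝ := 2 * L * (K * F + K ^ 2 * τ) with hTdef
  have hT0 : 0 ≤ T := by positivity
  let S : Set ((ι → ℂ) × (ι → ℂ)) :=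
    {y | (∀ i, ‖b i y.2‖ ≤ 2 * L * (K * ρ i)) ∧ 2 * L * T < ‖∑ i, y.1 i * b i y.2‖}
  have hS : MeasurableSet S := by
    refine measurableSet_forall_and (fun i => ?_) ?_
    · exact measurableSet_le ((hbm i).comp measurable_snd).norm measurable_const
    · refine measurableSet_lt measurable_const (Measurable.norm ?_)
      refine Finset.measurable_sum _ fun i _ => ?_
      exact ((measurable_pi_apply i).comp measurable_fst).mul ((hbm i).comp measurable_snd)
  have hmX : ∀ S : Finset ι, Measurable (fun ω i => if i ∈ S then x i ω else 0) := fun S => by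
    refine measurable_pi_lambda _ fun i => ?_
    by_cases hi : i ∈ S
    · simpa only [hi, if_true] using hx.measurable i
    · simp only [hi, if_false]; exact measurable_const
  have hquad : P {ω | ((fun i => if i ∈ I then x i ω else 0),
      (fun j => if j ∈ J then x j ω else 0)) ∈ S} ≤ 4 * e := by
    refine measure_indepFun_le (hmX I) (hmX J) (indepFun_ite_mem hx.measurable hx.indep hIJ) hS
      fun w => ?_
    by_cases hw : ∀ i, ‖b i w‖ ≤ 2 * L * (K * ρ i)
    · refine le_trans (measure_mono ?_) (measure_norm_sum_gt_le (T := T)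
        (Z := fun i ω => x i ω * b i w)
        (fun i => (hx.measurable i).mul_const _)
        (hx.indep.comp (fun i u => u * b i w) fun i => measurable_id.mul_const _)
        (fun i => ?_) (fun i => ?_) ?_ hT0 L)
      · rintro ω ⟨-, hω⟩
        refine lt_of_lt_of_eq hω ?_
        congr 1
        refine Finset.sum_congr rfl fun i _ => ?_
        by_cases hi : i ∈ I
        · simp [hi]
        · simp [hbI i w hi]
      · filter_upwards [hx.bound i] with ω hω
        rw [norm_mul]
        calc ‖x i ω‖ * ‖b i w‖ ≤ K * (2 * L * (K * ρ i)) :=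
              mul_le_mul hω (hw i) (norm_nonneg _) hK0
          _ = 2 * L * (K ^ 2 * ρ i) := by ring
          _ ≤ 2 * L * (K * F + K ^ 2 * τ) := by
              have h1 : K ^ 2 * ρ i ≤ K ^ 2 * τ := mul_le_mul_of_nonneg_left (hρτ i) (sq_nonneg _)
              have h2 : 0 ≤ K * F := mul_nonneg hK0 hF
              exact mul_le_mul_of_nonneg_left (by linarith) (by positivity)
      · rw [integral_mul_const, hx.mean i, zero_mul]
      · simp only [norm_mul, mul_pow, integral_mul_const, hx.second, one_mul]
        calc ∑ i, ‖b i w‖ ^ 2 ≤ ∑ i, (2 * L * K) ^ 2 * ρ i ^ 2 := by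
              refine Finset.sum_le_sum fun i _ => ?_
              calc ‖b i w‖ ^ 2 ≤ (2 * L * (K * ρ i)) ^ 2 :=
                    pow_le_pow_left₀ (norm_nonneg _) (hw i) 2
                _ = _ := by ring
          _ ≤ (2 * L * K) ^ 2 * F ^ 2 := by
              rw [← Finset.mul_sum]
              refine mul_le_mul_of_nonneg_left ?_ (sq_nonneg _)
              simpa only [hρ2] using hFro
          _ = (2 * L * (K * F)) ^ 2 := by ring
          _ ≤ T ^ 2 := by
              have : 0 ≤ K ^ 2 * τ := by positivity
              refine pow_le_pow_left₀ (by positivity) ?_ 2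
              exact mul_le_mul_of_nonneg_left (by linarith) (by positivity)
    · have : {ω | ((fun i => if i ∈ I then x i ω else 0), w) ∈ S} = ∅ := by
        ext ω; simp only [Set.mem_empty_iff_false, iff_false]
        exact fun h => hw h.1
      rw [this, measure_empty]; exact bot_le
  calc _ ≤ P ((⋃ i, {ω | 2 * L * (K * ρ i) < ‖b i (fun j => x j ω)‖}) ∪
        {ω | ((fun i => if i ∈ I then x i ω else 0),
          (fun j => if j ∈ J then x j ω else 0)) ∈ S}) := by
        refine measure_mono fun ω hω => ?_
        by_cases h : ∃ i, 2 * L * (K * ρ i) < ‖b i (fun j => x j ω)‖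
        · exact Or.inl (Set.mem_iUnion.2 h)
        · push Not at h
          refine Or.inr ⟨fun i => ?_, ?_⟩
          · simpa only [hbJ] using h i
          · have h1 : 2 * L * T = 4 * L ^ 2 * (K * F + K ^ 2 * τ) := by rw [hTdef]; ring
            rw [h1]
            refine lt_of_lt_of_eq hω ?_
            congr 1
            refine Finset.sum_congr rfl fun i _ => ?_
            simp only [hbJ]
            by_cases hi : i ∈ I
            · simp only [hi, if_true, b, Finset.mul_sum, mul_assoc]
            · rw [hbI i _ hi, mul_zero]
              exact Finset.sum_eq_zero fun j _ => by
                rw [ha i j (fun h => hi h.1), mul_zero, zero_mul]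
    _ ≤ (∑ _i : ι, 4 * e) + 4 * e := (measure_union_le _ _).trans
        (add_le_add ((measure_iUnion_fintype_le _ _).trans
          (Finset.sum_le_sum fun i _ => hlin i)) hquad)
    _ = _ := by
        rw [Finset.sum_const, Finset.card_univ, nsmul_eq_mul]; ring

/-- The diagonal part of a quadratic form: the variance of `|x i|² - 1` is at most `K²`. -/
theorem IsBoundedStandard.measure_diagonal_gt_le {Ω ι : Type*} [MeasurableSpace Ω]
    {P : Measure Ω} [IsProbabilityMeasure P] [Fintype ι] {x : ι → Ω → ℂ} {K : ℝ}
    (hx : IsBoundedStandard P x K) (hK : 1 ≤ K) {a : ι → ℂ} {τ F : ℝ} (hτ : 0 ≤ τ)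
    (hF : 0 ≤ F) (hrow : ∀ i, ‖a i‖ ≤ τ) (hFro : ∑ i, ‖a i‖ ^ 2 ≤ F ^ 2) (L : ℝ) :
    P {ω | 2 * L * (K * F + K ^ 2 * τ) <
        ‖(∑ i, x i ω * a i * (starRingEnd ℂ) (x i ω)) - ∑ i, a i‖} ≤
      4 * ENNReal.ofReal (Real.exp (1 - L)) := by
  have hK0 : 0 ≤ K := zero_le_one.trans hK
  have hK2 : 1 ≤ K ^ 2 := one_le_pow₀ hK
  have h0 : ∀ i, ∀ᵐ ω ∂P, |‖x i ω‖ ^ 2 - 1| ≤ K ^ 2 := fun i => by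
    filter_upwards [hx.bound i] with ω hω
    have := pow_le_pow_left₀ (norm_nonneg _) hω 2
    have := sq_nonneg ‖x i ω‖
    rw [abs_le]; constructor <;> linarith
  have hi2 : ∀ i, Integrable (fun ω => ‖x i ω‖ ^ 2) P := fun i =>
    Integrable.of_bound ((hx.measurable i).norm.pow_const 2).aestronglyMeasurable (K ^ 2) (by
      filter_upwards [hx.bound i] with ω hω
      rw [norm_pow, norm_norm]
      exact pow_le_pow_left₀ (norm_nonneg _) hω 2)
  have hmean : ∀ i, ∫ ω, (‖x i ω‖ ^ 2 - 1) ∂P = 0 := fun i => by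
    rw [integral_sub (hi2 i) (integrable_const _), hx.second i]; simp
  have hvar : ∀ i, ∫ ω, (‖x i ω‖ ^ 2 - 1) ^ 2 ∂P ≤ K ^ 2 := fun i => by
    calc ∫ ω, (‖x i ω‖ ^ 2 - 1) ^ 2 ∂P
        ≤ ∫ ω, (K ^ 2 * ‖x i ω‖ ^ 2 - (‖x i ω‖ ^ 2 - 1) - ‖x i ω‖ ^ 2 ) ∂P := by
          refine integral_mono_of_nonneg (ae_of_all _ fun ω => sq_nonneg _)
            ((((hi2 i).const_mul _).sub ((hi2 i).sub (integrable_const _))).sub (hi2 i)) ?_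
          filter_upwards [hx.bound i] with ω hω
          have := pow_le_pow_left₀ (norm_nonneg _) hω 2
          nlinarith [sq_nonneg ‖x i ω‖]
      _ = K ^ 2 - 1 := by
          rw [integral_sub (f := fun ω => K ^ 2 * ‖x i ω‖ ^ 2 - (‖x i ω‖ ^ 2 - 1))
              (((hi2 i).const_mul _).sub ((hi2 i).sub (integrable_const _))) (hi2 i),
            integral_sub (g := fun ω => ‖x i ω‖ ^ 2 - 1) ((hi2 i).const_mul _)
              ((hi2 i).sub (integrable_const _)), hmean i,
            integral_const_mul, hx.second i]
          ring
      _ ≤ K ^ 2 := by linarith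
  have hmeas : ∀ i, Measurable fun w : ℂ => a i * ((‖w‖ ^ 2 - 1 : ℝ) : ℂ) := fun i => by
    fun_prop
  refine le_trans (measure_mono ?_) (measure_norm_sum_gt_le (T := K * F + K ^ 2 * τ)
    (Z := fun i ω => a i * ((‖x i ω‖ ^ 2 - 1 : ℝ) : ℂ))
    (fun i => (hmeas i).comp (hx.measurable i))
    (hx.indep.comp (fun i w => a i * ((‖w‖ ^ 2 - 1 : ℝ) : ℂ)) hmeas)
    (fun i => ?_) (fun i => ?_) ?_ (by positivity) L)
  · intro ω hω
    rw [Set.mem_ofPred_eq] at hω ⊢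
    refine lt_of_lt_of_eq hω ?_
    rw [← Finset.sum_sub_distrib]
    congr 1
    refine Finset.sum_congr rfl fun i _ => ?_
    have := Complex.mul_conj' (x i ω)
    push_cast
    rw [← this]; ring
  · filter_upwards [h0 i] with ω hω
    rw [norm_mul, Complex.norm_real, Real.norm_eq_abs]
    have h1 : ‖a i‖ * |‖x i ω‖ ^ 2 - 1| ≤ τ * K ^ 2 :=
      mul_le_mul (hrow i) hω (abs_nonneg _) hτ
    have h2 : 0 ≤ K * F := mul_nonneg hK0 hF
    linarith
  · rw [integral_const_mul, integral_complex_ofReal, hmean i]; simp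
  · simp only [norm_mul, Complex.norm_real, Real.norm_eq_abs, mul_pow, sq_abs,
      integral_const_mul]
    calc ∑ i, ‖a i‖ ^ 2 * ∫ ω, (‖x i ω‖ ^ 2 - 1) ^ 2 ∂P ≤ ∑ i, ‖a i‖ ^ 2 * K ^ 2 :=
          Finset.sum_le_sum fun i _ => mul_le_mul_of_nonneg_left (hvar i) (sq_nonneg _)
      _ ≤ F ^ 2 * K ^ 2 := by rw [← Finset.sum_mul]; gcongr
      _ = (K * F) ^ 2 := by ring
      _ ≤ _ := by
          have : 0 ≤ K ^ 2 * τ := by positivity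
          exact pow_le_pow_left₀ (by positivity) (by linarith) 2

/-! ### Concentration of quadratic forms -/

/-- `b` is the lowest binary digit in which `i` and `j` differ. -/
def IsFirstDiffBit (b i j : ℕ) : Prop :=
  i.testBit b ≠ j.testBit b ∧ ∀ c < b, i.testBit c = j.testBit c

theorem IsFirstDiffBit.unique {b c i j : ℕ} (hb : IsFirstDiffBit b i j)
    (hc : IsFirstDiffBit c i j) : b = c := by
  rcases lt_trichotomy b c with h | h | h
  · exact absurd (hc.2 b h) hb.1
  · exact h
  · exact absurd (hb.2 c h) hc.1

theorem exists_isFirstDiffBit {m i j : ℕ} (hi : i < 2 ^ m) (hj : j < 2 ^ m) (hij : i ≠ j) :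
    ∃ b < m, IsFirstDiffBit b i j := by
  classical
  have hex : ∃ b, i.testBit b ≠ j.testBit b := by
    by_contra! h
    exact hij (Nat.eq_of_testBit_eq h)
  refine ⟨Nat.find hex, ?_, Nat.find_spec hex, fun c hc => not_not.1 (Nat.find_min hex hc)⟩
  by_contra! h
  have h2 : (2 : ℕ) ^ m ≤ 2 ^ Nat.find hex := Nat.pow_le_pow_right (by norm_num) h
  apply Nat.find_spec hex
  rw [Nat.testBit_lt_two_pow (hi.trans_le h2), Nat.testBit_lt_two_pow (hj.trans_le h2)]

open Classical in
/-- The part of the matrix `a` supported on the pairs whose lowest differing digit is `b`, with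
digit `s` in the row index. Row and column indices then have distinct digits `b`, so they range
over disjoint sets. -/
noncomputable def bitBlock {d : ℕ} (a : Fin d → Fin d → ℂ) (b : ℕ) (s : Bool)
    (i j : Fin d) : ℂ :=
  if IsFirstDiffBit b i j ∧ (i : ℕ).testBit b = s then a i j else 0

theorem norm_bitBlock_le {d : ℕ} (a : Fin d → Fin d → ℂ) (b : ℕ) (s : Bool) (i j : Fin d) :
    ‖bitBlock a b s i j‖ ≤ ‖a i j‖ := by
  unfold bitBlock
  split_ifs <;> simp

/-- The off-diagonal part of a `d × d` matrix splits into `2 * m` blocks supported on rectangles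
with disjoint sides when `d ≤ 2 ^ m`. -/
theorem sum_bitBlock {d m : ℕ} (hd : d ≤ 2 ^ m) (a : Fin d → Fin d → ℂ) {i j : Fin d}
    (hij : i ≠ j) : ∑ t : Fin m × Bool, bitBlock a t.1 t.2 i j = a i j := by
  obtain ⟨b, hbm, hb⟩ := exists_isFirstDiffBit (i.2.trans_le hd) (j.2.trans_le hd)
    (fun h => hij (Fin.ext h))
  rw [Finset.sum_eq_single (⟨b, hbm⟩, (i : ℕ).testBit b)]
  · simp [bitBlock, hb]
  · rintro ⟨c, s⟩ - hne
    unfold bitBlock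
    rw [if_neg]
    rintro ⟨hc, hs⟩
    obtain rfl := hb.unique hc
    exact hne (by ext <;> simp_all)
  · simp

/-- A Hanson–Wright type bound for bounded variables. Cutting the off-diagonal part into
`bitBlock`s replaces decoupling and costs a factor logarithmic in the dimension. -/
theorem IsBoundedStandard.measure_quadratic_gt_le {Ω : Type*} [MeasurableSpace Ω]
    {P : Measure Ω} [IsProbabilityMeasure P] {d m : ℕ} (hd : d ≤ 2 ^ m) {x : Fin d → Ω → ℂ}
    {K : ℝ} (hx : IsBoundedStandard P x K) (hK : 1 ≤ K) {a : Fin d → Fin d → ℂ} {τ F : ℝ}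
    (hτ : 0 ≤ τ) (hF : 0 ≤ F) (hrow : ∀ i, ∑ j, ‖a i j‖ ^ 2 ≤ τ ^ 2)
    (hFro : ∑ i, ∑ j, ‖a i j‖ ^ 2 ≤ F ^ 2) {L : ℝ} (hL : 1 ≤ L) :
    P {ω | (8 * m + 2) * L ^ 2 * (K * F + K ^ 2 * τ) <
        ‖(∑ i, ∑ j, x i ω * a i j * (starRingEnd ℂ) (x j ω)) - ∑ i, a i i‖} ≤
      (8 * m * (d + 1) + 4) * ENNReal.ofReal (Real.exp (1 - L)) := by
  classical
  have hL0 : 0 ≤ L := zero_le_one.trans hL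
  have hK0 : 0 ≤ K := zero_le_one.trans hK
  set e := ENNReal.ofReal (Real.exp (1 - L))
  set N := K * F + K ^ 2 * τ with hN
  have hN0 : 0 ≤ N := by positivity
  let q : Fin m × Bool → Ω → ℂ := fun t ω =>
    ∑ i, ∑ j, x i ω * bitBlock a t.1 t.2 i j * (starRingEnd ℂ) (x j ω)
  have hblock : ∀ t : Fin m × Bool, P {ω | 4 * L ^ 2 * N < ‖q t ω‖} ≤ (4 * (d + 1)) * e := by
    rintro ⟨b, s⟩
    have hmono : ∀ i, ∑ j, ‖bitBlock a b s i j‖ ^ 2 ≤ ∑ j, ‖a i j‖ ^ 2 := fun i =>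
      Finset.sum_le_sum fun j _ =>
        pow_le_pow_left₀ (norm_nonneg _) (norm_bitBlock_le a b s i j) 2
    have := hx.measure_bilinear_gt_le hK
      (I := Finset.univ.filter fun i : Fin d => (i : ℕ).testBit b = s)
      (J := Finset.univ.filter fun i : Fin d => ¬ (i : ℕ).testBit b = s)
      (Finset.disjoint_filter_filter_not _ _ _) (a := bitBlock a b s) ?_ hτ hF
      (fun i => (hmono i).trans (hrow i))
      ((Finset.sum_le_sum fun i _ => hmono i).trans hFro) hL0
    · simpa using this
    · intro i j hij
      unfold bitBlock
      rw [if_neg]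
      rintro ⟨h1, h2⟩
      refine hij ⟨by simpa using h2, ?_⟩
      simp only [Finset.mem_filter, Finset.mem_univ, true_and]
      rw [← h2]
      exact fun h => h1.1 h.symm
  have hdiag := hx.measure_diagonal_gt_le hK (a := fun i => a i i) hτ hF
    (fun i => by
      refine abs_le_of_sq_le_sq' ?_ hτ |>.2
      exact (Finset.single_le_sum (f := fun j => ‖a i j‖ ^ 2) (fun j _ => sq_nonneg _)
        (Finset.mem_univ i)).trans (hrow i))
    ((Finset.sum_le_sum fun i _ => Finset.single_le_sum (f := fun j => ‖a i j‖ ^ 2)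
      (fun j _ => sq_nonneg _) (Finset.mem_univ i)).trans hFro) L
  have hsplit : ∀ ω, (∑ i, ∑ j, x i ω * a i j * (starRingEnd ℂ) (x j ω)) - ∑ i, a i i =
      ∑ t, q t ω + ((∑ i, x i ω * a i i * (starRingEnd ℂ) (x i ω)) - ∑ i, a i i) := by
    intro ω
    have h1 : ∑ t, q t ω = ∑ i, ∑ j, x i ω * (∑ t : Fin m × Bool, bitBlock a t.1 t.2 i j) *
        (starRingEnd ℂ) (x j ω) := by
      simp only [q, Finset.mul_sum, Finset.sum_mul]
      rw [Finset.sum_comm]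
      exact Finset.sum_congr rfl fun i _ => Finset.sum_comm
    have h2 : ∀ i, ∑ t : Fin m × Bool, bitBlock a t.1 t.2 i i = 0 := fun i =>
      Finset.sum_eq_zero fun t _ => by
        unfold bitBlock
        rw [if_neg]
        exact fun h => h.1.1 rfl
    rw [h1, ← add_sub_assoc, ← Finset.sum_add_distrib]
    congr 1
    refine Finset.sum_congr rfl fun i _ => ?_
    rw [← Finset.add_sum_erase _ _ (Finset.mem_univ i),
      ← Finset.add_sum_erase (Finset.univ) (fun j => x i ω *
        (∑ t : Fin m × Bool, bitBlock a t.1 t.2 i j) * (starRingEnd ℂ) (x j ω))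
        (Finset.mem_univ i), h2, mul_zero, zero_mul, zero_add, add_comm]
    congr 1
    refine Finset.sum_congr rfl fun j hj => ?_
    rw [sum_bitBlock hd a (Finset.ne_of_mem_erase hj).symm]
  calc _ ≤ P ((⋃ t, {ω | 4 * L ^ 2 * N < ‖q t ω‖}) ∪ {ω | 2 * L * N <
        ‖(∑ i, x i ω * a i i * (starRingEnd ℂ) (x i ω)) - ∑ i, a i i‖}) := by
        refine measure_mono fun ω hω => ?_
        by_contra h
        simp only [Set.mem_union, Set.mem_iUnion, Set.mem_ofPred_eq, not_or, not_exists,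
          not_lt] at h hω
        rw [hsplit] at hω
        have h3 : ‖∑ t, q t ω‖ ≤ (2 * m) * (4 * L ^ 2 * N) := by
          refine (norm_sum_le _ _).trans ((Finset.sum_le_sum fun t _ => h.1 t).trans_eq ?_)
          simp only [Finset.sum_const, Finset.card_univ, Fintype.card_prod, Fintype.card_fin,
            Fintype.card_bool, nsmul_eq_mul]
          push_cast; ring
        have h4 := norm_add_le (∑ t, q t ω)
          ((∑ i, x i ω * a i i * (starRingEnd ℂ) (x i ω)) - ∑ i, a i i)
        have h5 : 2 * L * N ≤ 2 * L ^ 2 * N := by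
          refine mul_le_mul_of_nonneg_right ?_ hN0
          nlinarith
        have h6 := h.2
        nlinarith
    _ ≤ (∑ _t : Fin m × Bool, (4 * (d + 1)) * e) + 4 * e := (measure_union_le _ _).trans
        (add_le_add ((measure_iUnion_fintype_le _ _).trans
          (Finset.sum_le_sum fun i _ => hblock i)) hdiag)
    _ = _ := by
        simp only [Finset.sum_const, Finset.card_univ, Fintype.card_prod, Fintype.card_fin,
            Fintype.card_bool, nsmul_eq_mul]
        push_cast; ring

theorem IsBoundedStandard.measure_indep_quadratic_gt_le {Ω : Type*} [MeasurableSpace Ω]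
    {P : Measure Ω} [IsProbabilityMeasure P] {d m : ℕ} (hd : d ≤ 2 ^ m) {x : Fin d → Ω → ℂ}
    {K : ℝ} (hx : IsBoundedStandard P x K) (hK : 1 ≤ K) {A : Ω → Fin d → Fin d → ℂ}
    (hA : Measurable A) (hind : IndepFun (fun ω i => x i ω) A P)
    {τ L : ℝ} (hτ : 0 ≤ τ) (hL : 1 ≤ L) :
    P {ω | (∀ i, ∑ j, ‖A ω i j‖ ^ 2 ≤ τ ^ 2) ∧
        (8 * m + 2) * L ^ 2 * (K * √(∑ i, ∑ j, ‖A ω i j‖ ^ 2) + K ^ 2 * τ) <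
        ‖(∑ i, ∑ j, x i ω * A ω i j * (starRingEnd ℂ) (x j ω)) - ∑ i, A ω i i‖} ≤
      (8 * m * (d + 1) + 4) * ENNReal.ofReal (Real.exp (1 - L)) := by
  let S : Set ((Fin d → ℂ) × (Fin d → Fin d → ℂ)) :=
    {y | (∀ i, ∑ j, ‖y.2 i j‖ ^ 2 ≤ τ ^ 2) ∧
        (8 * m + 2) * L ^ 2 * (K * √(∑ i, ∑ j, ‖y.2 i j‖ ^ 2) + K ^ 2 * τ) <
        ‖(∑ i, ∑ j, y.1 i * y.2 i j * (starRingEnd ℂ) (y.1 j)) - ∑ i, y.2 i i‖}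
  have hS : MeasurableSet S := by
    refine measurableSet_forall_and (fun i => ?_) ?_
    · refine (isClosed_le ?_ continuous_const).measurableSet
      fun_prop
    · refine (isOpen_lt ?_ ?_).measurableSet
      · fun_prop
      · fun_prop
  refine measure_indepFun_le (measurable_pi_lambda _ hx.measurable) hA hind hS fun a => ?_
  by_cases ha : ∀ i, ∑ j, ‖a i j‖ ^ 2 ≤ τ ^ 2
  · refine le_trans (measure_mono fun ω hω => ?_) (hx.measure_quadratic_gt_le hd hK hτ
      (Real.sqrt_nonneg (∑ i, ∑ j, ‖a i j‖ ^ 2)) ha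
      (Real.sq_sqrt (Finset.sum_nonneg fun i _ => Finset.sum_nonneg fun j _ => sq_nonneg _)).ge hL)
    exact hω.2
  · have : {ω | ((fun i => x i ω), a) ∈ S} = ∅ := by
      ext ω; simp only [Set.mem_empty_iff_false, iff_false]
      exact fun h => ha h.1
    rw [this, measure_empty]; exact bot_le

/-! ### Resolvents of Gram matrices -/

/-- The resolvent `(Xᴴ X - z)⁻¹` of the Gram matrix of the columns of `X`. The resolvent of `X Xᴴ`
is `gramResolvent Xᴴ z`. It is a genuine inverse for `0 < z.im`, the only case used. -/
noncomputable def gramResolvent {m n : Type*} [Fintype m] [Fintype n] [DecidableEq n]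
    (X : Matrix m n ℂ) (z : ℂ) : Matrix n n ℂ :=
  (Xᴴ * X - z • (1 : Matrix n n ℂ))⁻¹

/-- Spectral formula for the resolvent of a Hermitian matrix. -/
theorem Matrix.IsHermitian.sub_smul_mul_eq_one {n : Type*} [Fintype n] [DecidableEq n]
    {H : Matrix n n ℂ} (hH : H.IsHermitian) {z : ℂ} (hz : 0 < z.im) :
    (H - z • (1 : Matrix n n ℂ)) * ((hH.eigenvectorUnitary : Matrix n n ℂ) *
      Matrix.diagonal (fun i => ((hH.eigenvalues i : ℂ) - z)⁻¹) *
      star (hH.eigenvectorUnitary : Matrix n n ℂ)) = 1 := by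
  set U : Matrix n n ℂ := (hH.eigenvectorUnitary : Matrix n n ℂ) with hU
  have hUU : U * star U = 1 := Unitary.coe_mul_star_self _
  have hUU' : star U * U = 1 := Unitary.coe_star_mul_self _
  have hne : ∀ i, (hH.eigenvalues i : ℂ) - z ≠ 0 := fun i h => by
    have := congrArg Complex.im h
    simp at this
    exact hz.ne' this
  have h1 : H - z • (1 : Matrix n n ℂ) =
      U * Matrix.diagonal (fun i => (hH.eigenvalues i : ℂ) - z) * star U := by
    have h2 : Matrix.diagonal (fun i => (hH.eigenvalues i : ℂ) - z) =
        Matrix.diagonal (RCLike.ofReal ∘ hH.eigenvalues) - z • (1 : Matrix n n ℂ) := by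
      ext i j
      by_cases hij : i = j
      · subst hij; simp
      · simp [hij]
    have h3 := hH.spectral_theorem
    rw [Unitary.conjStarAlgAut_apply] at h3
    rw [h2, Matrix.mul_sub, Matrix.sub_mul]
    rw [Matrix.mul_smul, Matrix.smul_mul, Matrix.mul_one, hUU]
    congr 1
  rw [h1]
  calc U * Matrix.diagonal (fun i => (hH.eigenvalues i : ℂ) - z) * star U *
        (U * Matrix.diagonal (fun i => ((hH.eigenvalues i : ℂ) - z)⁻¹) * star U)
      = U * Matrix.diagonal (fun i => (hH.eigenvalues i : ℂ) - z) * (star U * U) *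
          Matrix.diagonal (fun i => ((hH.eigenvalues i : ℂ) - z)⁻¹) * star U := by
        simp only [Matrix.mul_assoc]
    _ = U * (Matrix.diagonal (fun i => (hH.eigenvalues i : ℂ) - z) *
          Matrix.diagonal (fun i => ((hH.eigenvalues i : ℂ) - z)⁻¹)) * star U := by
        rw [hUU', Matrix.mul_one]; simp only [Matrix.mul_assoc]
    _ = 1 := by
        rw [Matrix.diagonal_mul_diagonal]
        simp [mul_inv_cancel₀ (hne _), hUU]

theorem sub_mul_gramResolvent {m n : Type*} [Fintype m] [Fintype n] [DecidableEq n]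
    (X : Matrix m n ℂ) {z : ℂ} (hz : 0 < z.im) :
    (Xᴴ * X - z • (1 : Matrix n n ℂ)) * gramResolvent X z = 1 :=
  Matrix.mul_nonsing_inv _ (Matrix.isUnit_det_of_right_inverse
    ((Matrix.isHermitian_conjTranspose_mul_self X).sub_smul_mul_eq_one hz))

theorem gramResolvent_mul_sub {m n : Type*} [Fintype m] [Fintype n] [DecidableEq n]
    (X : Matrix m n ℂ) {z : ℂ} (hz : 0 < z.im) :
    gramResolvent X z * (Xᴴ * X - z • (1 : Matrix n n ℂ)) = 1 :=
  Matrix.nonsing_inv_mul _ (Matrix.isUnit_det_of_right_inverse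
    ((Matrix.isHermitian_conjTranspose_mul_self X).sub_smul_mul_eq_one hz))

theorem conjTranspose_mul_sub_gramResolvent {m n : Type*} [Fintype m] [Fintype n] [DecidableEq n]
    (X : Matrix m n ℂ) {z : ℂ} (hz : 0 < z.im) :
    (gramResolvent X z)ᴴ * (Xᴴ * X - star z • (1 : Matrix n n ℂ)) = 1 := by
  have := congrArg Matrix.conjTranspose (sub_mul_gramResolvent X hz)
  simpa using this

theorem sub_mul_conjTranspose_gramResolvent {m n : Type*} [Fintype m] [Fintype n] [DecidableEq n]
    (X : Matrix m n ℂ) {z : ℂ} (hz : 0 < z.im) :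
    (Xᴴ * X - star z • (1 : Matrix n n ℂ)) * (gramResolvent X z)ᴴ = 1 := by
  have := congrArg Matrix.conjTranspose (gramResolvent_mul_sub X hz)
  simpa using this

/-- Resolvent (Ward) identity for `z` and its conjugate. -/
theorem gramResolvent_sub_conjTranspose {m n : Type*} [Fintype m] [Fintype n] [DecidableEq n]
    (X : Matrix m n ℂ) {z : ℂ} (hz : 0 < z.im) :
    gramResolvent X z - (gramResolvent X z)ᴴ =
      (z - star z) • ((gramResolvent X z)ᴴ * gramResolvent X z) := by
  set G := gramResolvent X z
  calc G - Gᴴ = Gᴴ * (Xᴴ * X - star z • (1 : Matrix n n ℂ)) * G -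
        Gᴴ * ((Xᴴ * X - z • (1 : Matrix n n ℂ)) * G) := by
        rw [sub_mul_gramResolvent X hz, conjTranspose_mul_sub_gramResolvent X hz, Matrix.one_mul,
          Matrix.mul_one]
    _ = _ := by
        rw [← Matrix.mul_assoc, ← Matrix.sub_mul, ← Matrix.mul_sub, sub_sub_sub_cancel_left,
          ← sub_smul]
        simp

theorem gramResolvent_sub_conjTranspose' {m n : Type*} [Fintype m] [Fintype n] [DecidableEq n]
    (X : Matrix m n ℂ) {z : ℂ} (hz : 0 < z.im) :
    gramResolvent X z - (gramResolvent X z)ᴴ =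
      (z - star z) • (gramResolvent X z * (gramResolvent X z)ᴴ) := by
  set G := gramResolvent X z
  calc G - Gᴴ = G * ((Xᴴ * X - star z • (1 : Matrix n n ℂ)) * Gᴴ) -
        G * (Xᴴ * X - z • (1 : Matrix n n ℂ)) * Gᴴ := by
        rw [gramResolvent_mul_sub X hz, sub_mul_conjTranspose_gramResolvent X hz, Matrix.one_mul,
          Matrix.mul_one]
    _ = _ := by
        rw [← Matrix.mul_assoc, ← Matrix.sub_mul, ← Matrix.mul_sub, sub_sub_sub_cancel_left,
          ← sub_smul]
        simp

theorem star_dotProduct_self_eq {n : Type*} [Fintype n] (v : n → ℂ) :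
    star v ⬝ᵥ v = ((∑ k, ‖v k‖ ^ 2 : ℝ) : ℂ) := by
  simp [dotProduct, Complex.conj_mul']

theorem im_eq_of_sub_star {z q : ℂ} {r : ℝ}
    (h : q - star q = (z - star z) * (r : ℂ)) :
    q.im = z.im * r := by
  have := congrArg Complex.im h
  simp at this
  linarith

theorem star_dotProduct_mulVec_star {n : Type*} [Fintype n]
    (A : Matrix n n ℂ) (v : n → ℂ) :
    star (v ⬝ᵥ A *ᵥ star v) = v ⬝ᵥ Aᴴ *ᵥ star v := by
  rw [← Matrix.star_dotProduct_star, Matrix.star_mulVec, star_star, Matrix.dotProduct_mulVec]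

/-- Ward identity for the quadratic form of the resolvent. With the version for `v ᵥ* G` it shows
that both `G v*` and `v G` have squared norm `Im (v G v*) / Im z`. -/
theorem im_dotProduct_gramResolvent {m n : Type*} [Fintype m] [Fintype n] [DecidableEq n]
    (X : Matrix m n ℂ) {z : ℂ} (hz : 0 < z.im) (v : n → ℂ) :
    (v ⬝ᵥ gramResolvent X z *ᵥ star v).im =
      z.im * ∑ k, ‖(gramResolvent X z *ᵥ star v) k‖ ^ 2 := by
  refine im_eq_of_sub_star ?_
  rw [star_dotProduct_mulVec_star, ← dotProduct_sub, ← Matrix.sub_mulVec,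
    gramResolvent_sub_conjTranspose X hz, Matrix.smul_mulVec, dotProduct_smul, smul_eq_mul,
    ← star_dotProduct_self_eq, ← Matrix.mulVec_mulVec, Matrix.dotProduct_mulVec,
    Matrix.star_mulVec, star_star]

theorem im_dotProduct_gramResolvent' {m n : Type*} [Fintype m] [Fintype n] [DecidableEq n]
    (X : Matrix m n ℂ) {z : ℂ} (hz : 0 < z.im) (v : n → ℂ) :
    (v ⬝ᵥ gramResolvent X z *ᵥ star v).im =
      z.im * ∑ k, ‖(v ᵥ* gramResolvent X z) k‖ ^ 2 := by
  refine im_eq_of_sub_star ?_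
  rw [star_dotProduct_mulVec_star, ← dotProduct_sub, ← Matrix.sub_mulVec,
    gramResolvent_sub_conjTranspose' X hz, Matrix.smul_mulVec, dotProduct_smul, smul_eq_mul,
    ← star_dotProduct_self_eq, dotProduct_comm (star _), Matrix.star_vecMul,
    ← Matrix.mulVec_mulVec, Matrix.dotProduct_mulVec]

theorem im_gramResolvent_diag {m n : Type*} [Fintype m] [Fintype n] [DecidableEq n]
    (X : Matrix m n ℂ) {z : ℂ} (hz : 0 < z.im) (j : n) :
    (gramResolvent X z j j).im = z.im * ∑ k, ‖gramResolvent X z j k‖ ^ 2 := by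
  have := im_dotProduct_gramResolvent' X hz (Pi.single j 1)
  simpa [Pi.star_single] using this

theorem sum_norm_sq_gramResolvent_le {m n : Type*} [Fintype m] [Fintype n] [DecidableEq n]
    (X : Matrix m n ℂ) {z : ℂ} (hz : 0 < z.im) (j : n) :
    ∑ k, ‖gramResolvent X z j k‖ ^ 2 ≤ (z.im)⁻¹ ^ 2 := by
  set r := ∑ k, ‖gramResolvent X z j k‖ ^ 2 with hr
  have hr0 : 0 ≤ r := Finset.sum_nonneg fun k _ => sq_nonneg _
  have h1 : z.im * r ≤ ‖gramResolvent X z j j‖ := by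
    rw [← im_gramResolvent_diag X hz]
    exact (le_abs_self _).trans (Complex.abs_im_le_norm _)
  have h2 : ‖gramResolvent X z j j‖ ^ 2 ≤ r :=
    Finset.single_le_sum (f := fun k => ‖gramResolvent X z j k‖ ^ 2) (fun k _ => sq_nonneg _)
      (Finset.mem_univ j)
  have h3 : (z.im * r) ^ 2 ≤ r := (pow_le_pow_left₀ (by positivity) h1 2).trans h2
  rcases hr0.eq_or_lt with h0 | h0
  · rw [← h0]; positivity
  · have h4 : z.im ^ 2 * r ≤ 1 := by
      by_contra! h
      nlinarith
    rw [inv_pow, ← one_div, le_div_iff₀ (by positivity)]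
    linarith

theorem im_trace_gramResolvent {m n : Type*} [Fintype m] [Fintype n] [DecidableEq n]
    (X : Matrix m n ℂ) {z : ℂ} (hz : 0 < z.im) :
    (gramResolvent X z).trace.im = z.im * ∑ j, ∑ k, ‖gramResolvent X z j k‖ ^ 2 := by
  rw [Matrix.trace, Complex.im_sum, Finset.mul_sum]
  exact Finset.sum_congr rfl fun j _ => im_gramResolvent_diag X hz j

theorem trace_gramResolvent {m n : Type*} [Fintype m] [Fintype n] [DecidableEq n]
    (X : Matrix m n ℂ) {z : ℂ} (hz : 0 < z.im) :
    (gramResolvent X z).trace =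
      ∑ i, (((Matrix.isHermitian_conjTranspose_mul_self X).eigenvalues i : ℂ) - z)⁻¹ := by
  have hH := Matrix.isHermitian_conjTranspose_mul_self X
  have h : gramResolvent X z = _ := Matrix.inv_eq_right_inv (hH.sub_smul_mul_eq_one hz)
  rw [h, Matrix.trace_mul_comm, ← Matrix.mul_assoc, Unitary.coe_star_mul_self, Matrix.one_mul,
    Matrix.trace_diagonal]

theorem im_trace_gramResolvent_eq_sum {m n : Type*} [Fintype m] [Fintype n] [DecidableEq n]
    (X : Matrix m n ℂ) {z : ℂ} (hz : 0 < z.im) :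
    (gramResolvent X z).trace.im =
      ∑ i, z.im / (((Matrix.isHermitian_conjTranspose_mul_self X).eigenvalues i - z.re) ^ 2 +
        z.im ^ 2) := by
  rw [trace_gramResolvent X hz, Complex.im_sum]
  refine Finset.sum_congr rfl fun i _ => ?_
  rw [Complex.inv_im, Complex.normSq_apply]
  simp
  ring_nf

/-- Halving the distance to the real axis at most halves the imaginary part of the trace. -/
theorem half_im_trace_gramResolvent_le {m n : Type*} [Fintype m] [Fintype n] [DecidableEq n]
    (X : Matrix m n ℂ) (E : ℝ) {η : ℝ} (hη : 0 < η) :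
    (gramResolvent X (E + η * Complex.I)).trace.im / 2 ≤
      (gramResolvent X (E + (η / 2 : ℝ) * Complex.I)).trace.im := by
  rw [im_trace_gramResolvent_eq_sum X (by simpa using hη),
    im_trace_gramResolvent_eq_sum X (by simpa using hη), Finset.sum_div]
  refine Finset.sum_le_sum fun i _ => ?_
  simp only [Complex.add_re, Complex.ofReal_re, Complex.mul_re, Complex.I_re, mul_zero,
    Complex.ofReal_im, Complex.I_im, mul_one, sub_self, add_zero, Complex.add_im, Complex.mul_im,
    zero_add]
  rw [div_div, div_div, div_le_div_iff₀ (by positivity) (by positivity)]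
  have := sq_nonneg ((Matrix.isHermitian_conjTranspose_mul_self X).eigenvalues i - E)
  nlinarith [mul_nonneg hη.le this, mul_pos hη (mul_pos hη hη)]

open scoped ComplexOrder in
/-- At distance one from the real axis the density of eigenvalues is bounded below: at least half
of the eigenvalues lie in `[0, 4]`, because their average is at most `2`. -/
theorem card_div_le_im_trace_gramResolvent {m n : Type*} [Fintype m] [Fintype n] [DecidableEq n]
    (X : Matrix m n ℂ) {E : ℝ} (hE0 : 0 ≤ E) (hE : E ≤ 5)
    (hX : ∑ i, ∑ j, ‖X i j‖ ^ 2 ≤ 2 * Fintype.card n) :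
    (Fintype.card n : ℝ) / 52 ≤ (gramResolvent X (E + (1 : ℝ) * Complex.I)).trace.im := by
  rw [im_trace_gramResolvent_eq_sum X (by simp)]
  set hH := Matrix.isHermitian_conjTranspose_mul_self X
  simp only [Complex.add_re, Complex.ofReal_re, Complex.mul_re, Complex.I_re, mul_zero,
    Complex.ofReal_im, Complex.I_im, mul_one, sub_self, add_zero, Complex.add_im, Complex.mul_im,
    zero_add]
  have hpos : ∀ i, 0 ≤ hH.eigenvalues i :=
    fun i => (Matrix.posSemidef_conjTranspose_mul_self X).eigenvalues_nonneg i
  have htr : ∑ i, hH.eigenvalues i = ∑ i, ∑ j, ‖X i j‖ ^ 2 := by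
    have h1 := hH.trace_eq_sum_eigenvalues
    have h2 : (Xᴴ * X).trace = ((∑ i, ∑ j, ‖X i j‖ ^ 2 : ℝ) : ℂ) := by
      rw [Finset.sum_comm]
      simp [Matrix.trace, Matrix.mul_apply, Complex.conj_mul']
    rw [h2] at h1
    have := congrArg Complex.re h1
    rw [Complex.ofReal_re] at this
    simpa using this.symm
  have hterm : ∀ i, (1 - hH.eigenvalues i / 4) / 26 ≤
      1 / ((hH.eigenvalues i - E) ^ 2 + 1 ^ 2) := fun i => by
    have h0 := hpos i
    rw [div_le_div_iff₀ (by norm_num) (by positivity)]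
    by_cases h4 : hH.eigenvalues i ≤ 4
    · have : (hH.eigenvalues i - E) ^ 2 ≤ 25 := by
        have := sq_le_sq' (a := hH.eigenvalues i - E) (b := 5) (by linarith) (by linarith)
        linarith
      nlinarith
    · push Not at h4
      have : (1 - hH.eigenvalues i / 4) * ((hH.eigenvalues i - E) ^ 2 + 1 ^ 2) ≤ 0 :=
        mul_nonpos_of_nonpos_of_nonneg (by linarith) (by positivity)
      linarith
  refine le_trans ?_ (Finset.sum_le_sum fun i _ => hterm i)
  rw [← Finset.sum_div, Finset.sum_sub_distrib, ← Finset.sum_div, htr]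
  simp only [Finset.sum_const, Finset.card_univ, nsmul_eq_mul, mul_one]
  linarith

/-- The resolvents of `X Xᴴ` and `Xᴴ X` determine each other. -/
theorem smul_gramResolvent_conjTranspose {m n : Type*} [Fintype m] [Fintype n] [DecidableEq m]
    [DecidableEq n] (X : Matrix m n ℂ) {z : ℂ} (hz : 0 < z.im) :
    z • gramResolvent Xᴴ z = X * gramResolvent X z * Xᴴ - 1 := by
  have hz0 : z ≠ 0 := fun h => by simp [h] at hz
  have h1 : (Xᴴᴴ * Xᴴ - z • (1 : Matrix m m ℂ)) * (X * gramResolvent X z * Xᴴ - 1) =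
      z • (1 : Matrix m m ℂ) := by
    rw [Matrix.conjTranspose_conjTranspose]
    calc (X * Xᴴ - z • (1 : Matrix m m ℂ)) * (X * gramResolvent X z * Xᴴ - 1)
        = X * ((Xᴴ * X - z • (1 : Matrix n n ℂ)) * gramResolvent X z) * Xᴴ - X * Xᴴ +
            z • (1 : Matrix m m ℂ) := by
          simp only [Matrix.mul_sub, Matrix.sub_mul, Matrix.mul_one, Matrix.smul_mul,
            Matrix.one_mul, Matrix.mul_smul, Matrix.mul_assoc]
          abel
      _ = _ := by rw [sub_mul_gramResolvent X hz, Matrix.mul_one]; abel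
  have h2 := congrArg (fun B => gramResolvent Xᴴ z * B) h1
  simp only [← Matrix.mul_assoc] at h2
  rw [gramResolvent_mul_sub Xᴴ hz, Matrix.one_mul] at h2
  rw [h2, Matrix.mul_smul, Matrix.mul_one]

/-- The spectra of `X Xᴴ` and `Xᴴ X` agree up to zeros. -/
theorem mul_trace_gramResolvent_conjTranspose {m n : Type*} [Fintype m] [Fintype n] [DecidableEq m]
    [DecidableEq n] (X : Matrix m n ℂ) {z : ℂ} (hz : 0 < z.im) :
    z * (gramResolvent Xᴴ z).trace =
      z * (gramResolvent X z).trace + Fintype.card n - Fintype.card m := by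
  have h1 := congrArg Matrix.trace (smul_gramResolvent_conjTranspose X hz)
  rw [Matrix.trace_smul, Matrix.trace_sub, Matrix.trace_mul_comm, ← Matrix.mul_assoc,
    Matrix.trace_one, smul_eq_mul] at h1
  have h2 := congrArg Matrix.trace (sub_mul_gramResolvent X hz)
  rw [Matrix.sub_mul, Matrix.trace_sub, Matrix.smul_mul, Matrix.one_mul, Matrix.trace_smul,
    Matrix.trace_one, smul_eq_mul] at h2
  rw [h1, ← h2]; ring

/-- The quadratic form of the row `X i` with the resolvent of the matrix in which this row has been
removed. Removal means replacement by zero, which leaves `Xᴴ X` the same as deletion and keeps the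
size fixed. -/
noncomputable def minorForm {m n : Type*} [Fintype m] [Fintype n] [DecidableEq m]
    [DecidableEq n] (X : Matrix m n ℂ) (i : m) (z : ℂ) : ℂ :=
  X i ⬝ᵥ gramResolvent (X.updateRow i 0) z *ᵥ star (X i)

theorem conjTranspose_mul_self_updateRow {m n : Type*} [Fintype m] [DecidableEq m]
    (X : Matrix m n ℂ) (i : m) :
    Xᴴ * X = (X.updateRow i 0)ᴴ * X.updateRow i 0 + Matrix.vecMulVec (star (X i)) (X i) := by
  ext j k
  simp only [Matrix.mul_apply, Matrix.add_apply, Matrix.conjTranspose_apply,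
    Matrix.vecMulVec_apply, Pi.star_apply]
  rw [← Finset.add_sum_erase _ _ (Finset.mem_univ i),
    ← Finset.add_sum_erase _ (fun l => star (X.updateRow i 0 l j) * X.updateRow i 0 l k)
      (Finset.mem_univ i)]
  simp only [Matrix.updateRow_self, Pi.zero_apply, star_zero, zero_mul, zero_add]
  rw [add_comm]
  congr 1
  refine Finset.sum_congr rfl fun l hl => ?_
  rw [Matrix.updateRow_ne (Finset.ne_of_mem_erase hl)]

/-- Sherman–Morrison formula, applied to the vector of the rank-one perturbation. -/
theorem one_add_minorForm_smul {m n : Type*} [Fintype m] [Fintype n] [DecidableEq m]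
    [DecidableEq n] (X : Matrix m n ℂ) {z : ℂ} (hz : 0 < z.im) (i : m) :
    (1 + minorForm X i z) • (gramResolvent X z *ᵥ star (X i)) =
      gramResolvent (X.updateRow i 0) z *ᵥ star (X i) := by
  set G0 := gramResolvent (X.updateRow i 0) z with hG0
  have h1 : (Xᴴ * X - z • (1 : Matrix n n ℂ)) *ᵥ (G0 *ᵥ star (X i)) =
      (1 + minorForm X i z) • star (X i) := by
    rw [conjTranspose_mul_self_updateRow X i, add_sub_right_comm, Matrix.add_mulVec,
      Matrix.mulVec_mulVec, sub_mul_gramResolvent _ hz, Matrix.one_mulVec,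
      Matrix.vecMulVec_mulVec, add_smul, one_smul, op_smul_eq_smul]
    rfl
  have h2 := congrArg (fun v => gramResolvent X z *ᵥ v) h1
  simp only [Matrix.mulVec_mulVec] at h2
  rw [Matrix.mulVec_smul, ← Matrix.mul_assoc, gramResolvent_mul_sub X hz] at h2
  rw [← h2, Matrix.one_mul]

/-- Schur complement formula for the diagonal of the resolvent of `X Xᴴ`. -/
theorem mul_gramResolvent_diag_mul {m n : Type*} [Fintype m] [Fintype n] [DecidableEq m]
    [DecidableEq n] (X : Matrix m n ℂ) {z : ℂ} (hz : 0 < z.im) (i : m) :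
    z * gramResolvent Xᴴ z i i * (1 + minorForm X i z) = -1 := by
  have h1 : z * gramResolvent Xᴴ z i i = X i ⬝ᵥ (gramResolvent X z *ᵥ star (X i)) - 1 := by
    have := congrFun (congrFun (smul_gramResolvent_conjTranspose X hz) i) i
    simp only [Matrix.smul_apply, Matrix.sub_apply, Matrix.one_apply_eq, smul_eq_mul] at this
    rw [this, Matrix.mul_assoc, Matrix.mul_apply']
    rfl
  have h2 := congrArg (fun v => X i ⬝ᵥ v) (one_add_minorForm_smul X hz i)
  simp only [dotProduct_smul, smul_eq_mul] at h2
  rw [h1]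
  have h3 : X i ⬝ᵥ gramResolvent (X.updateRow i 0) z *ᵥ star (X i) = minorForm X i z := rfl
  rw [h3] at h2
  linear_combination h2

/-- Removing a row changes the trace of the resolvent by at most `1 / Im z`. -/
theorem norm_trace_gramResolvent_sub_le {m n : Type*} [Fintype m] [Fintype n] [DecidableEq m]
    [DecidableEq n] (X : Matrix m n ℂ) {z : ℂ} (hz : 0 < z.im) (i : m) :
    ‖(gramResolvent (X.updateRow i 0) z).trace - (gramResolvent X z).trace‖ ≤ (z.im)⁻¹ := by
  set G0 := gramResolvent (X.updateRow i 0) z with hG0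
  set G := gramResolvent X z with hG
  set q := minorForm X i z with hq
  have hne : 1 + q ≠ 0 := fun h => by
    have := mul_gramResolvent_diag_mul X hz i
    rw [← hq, h, mul_zero] at this
    norm_num at this
  have h1 : G0 - G = Matrix.vecMulVec (G *ᵥ star (X i)) (X i ᵥ* G0) := by
    calc G0 - G = G * (Xᴴ * X - z • (1 : Matrix n n ℂ)) * G0 -
          G * (((X.updateRow i 0)ᴴ * X.updateRow i 0 - z • (1 : Matrix n n ℂ)) * G0) := by
          rw [gramResolvent_mul_sub X hz, sub_mul_gramResolvent _ hz, Matrix.one_mul,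
            Matrix.mul_one]
      _ = G * Matrix.vecMulVec (star (X i)) (X i) * G0 := by
          rw [← Matrix.mul_assoc, ← Matrix.sub_mul, ← Matrix.mul_sub,
            conjTranspose_mul_self_updateRow X i]
          congr 2; abel
      _ = _ := by rw [Matrix.mul_vecMulVec, Matrix.vecMulVec_mul]
  have h2 : (1 + q) * (G0.trace - G.trace) = (G0 *ᵥ star (X i)) ⬝ᵥ (X i ᵥ* G0) := by
    rw [← Matrix.trace_sub, h1, Matrix.trace_vecMulVec, ← one_add_minorForm_smul X hz i,
      smul_dotProduct, smul_eq_mul]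
  have h3 : ‖(G0 *ᵥ star (X i)) ⬝ᵥ (X i ᵥ* G0)‖ ≤ q.im / z.im := by
    have e1 := im_dotProduct_gramResolvent (X.updateRow i 0) hz (X i)
    have e2 := im_dotProduct_gramResolvent' (X.updateRow i 0) hz (X i)
    have e1' : ∑ k, ‖(G0 *ᵥ star (X i)) k‖ ^ 2 = q.im / z.im := by
      rw [eq_div_iff hz.ne', mul_comm]; exact e1.symm
    have e2' : ∑ k, ‖(X i ᵥ* G0) k‖ ^ 2 = q.im / z.im := by
      rw [eq_div_iff hz.ne', mul_comm]; exact e2.symm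
    calc ‖(G0 *ᵥ star (X i)) ⬝ᵥ (X i ᵥ* G0)‖
        ≤ ∑ k, ‖(G0 *ᵥ star (X i)) k‖ * ‖(X i ᵥ* G0) k‖ := by
          refine (norm_sum_le _ _).trans (le_of_eq ?_)
          simp only [norm_mul]
      _ ≤ ∑ k, (‖(G0 *ᵥ star (X i)) k‖ ^ 2 + ‖(X i ᵥ* G0) k‖ ^ 2) / 2 :=
          Finset.sum_le_sum fun k _ => by
            linarith [two_mul_le_add_sq ‖(G0 *ᵥ star (X i)) k‖ ‖(X i ᵥ* G0) k‖]
      _ = q.im / z.im := by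
          rw [← Finset.sum_div, Finset.sum_add_distrib, e1', e2']; ring
  have h4 : q.im ≤ ‖1 + q‖ := by
    have := (le_abs_self _).trans (Complex.abs_im_le_norm (1 + q))
    simpa using this
  have h5 : ‖1 + q‖ * ‖G0.trace - G.trace‖ ≤ ‖1 + q‖ * (z.im)⁻¹ := by
    rw [← norm_mul, h2]
    refine h3.trans ?_
    rw [div_eq_mul_inv]
    exact mul_le_mul_of_nonneg_right h4 (inv_nonneg.2 hz.le)
  exact le_of_mul_le_mul_left h5 (norm_pos_iff.2 hne)

/-- Diagonal resolvent entries control the coordinates of every unit eigenvector, whatever the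
multiplicity of its eigenvalue. -/
theorem norm_sq_apply_le_of_eigenvector {m n : Type*} [Fintype m] [Fintype n] [DecidableEq n]
    (X : Matrix m n ℂ) {z : ℂ} (hz : 0 < z.im) {lam : ℝ} {v : n → ℂ} (hv : ∑ k, ‖v k‖ ^ 2 = 1)
    (hlam : (Xᴴ * X) *ᵥ v = (lam : ℂ) • v) (j : n) :
    ‖v j‖ ^ 2 ≤ ((lam - z.re) ^ 2 + z.im ^ 2) / z.im * ‖gramResolvent X z j j‖ := by
  set G := gramResolvent X z with hG
  have h1 : (Xᴴ * X - z • (1 : Matrix n n ℂ)) *ᵥ v = ((lam : ℂ) - z) • v := by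
    rw [Matrix.sub_mulVec, hlam, Matrix.smul_mulVec, Matrix.one_mulVec, sub_smul]
  have h2 := congrArg (fun w => G *ᵥ w) h1
  simp only [Matrix.mulVec_mulVec] at h2
  rw [gramResolvent_mul_sub X hz, Matrix.one_mulVec, Matrix.mulVec_smul] at h2
  have h3 : v j = ((lam : ℂ) - z) * ∑ k, G j k * v k := by
    conv_lhs => rw [h2]
    rfl
  have h4 : ‖∑ k, G j k * v k‖ ^ 2 ≤ ∑ k, ‖G j k‖ ^ 2 := by
    calc ‖∑ k, G j k * v k‖ ^ 2 ≤ (∑ k, ‖G j k‖ * ‖v k‖) ^ 2 := by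
          refine pow_le_pow_left₀ (norm_nonneg _) ((norm_sum_le _ _).trans (le_of_eq ?_)) 2
          simp only [norm_mul]
      _ ≤ (∑ k, ‖G j k‖ ^ 2) * ∑ k, ‖v k‖ ^ 2 := Finset.sum_mul_sq_le_sq_mul_sq _ _ _
      _ = _ := by rw [hv, mul_one]
  have h5 : ∑ k, ‖G j k‖ ^ 2 ≤ ‖G j j‖ / z.im := by
    rw [le_div_iff₀ hz, mul_comm, ← im_gramResolvent_diag X hz]
    exact (le_abs_self _).trans (Complex.abs_im_le_norm _)
  have h6 : ‖(lam : ℂ) - z‖ ^ 2 = (lam - z.re) ^ 2 + z.im ^ 2 := by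
    rw [← Complex.normSq_eq_norm_sq, Complex.normSq_apply]
    simp
    ring
  rw [h3, norm_mul, mul_pow, h6]
  calc ((lam - z.re) ^ 2 + z.im ^ 2) * ‖∑ k, G j k * v k‖ ^ 2
      ≤ ((lam - z.re) ^ 2 + z.im ^ 2) * (‖G j j‖ / z.im) :=
        mul_le_mul_of_nonneg_left (h4.trans h5) (by positivity)
    _ = _ := by ring

/-! ### The self-consistent equation and the descent in scale -/

theorem re_ofReal_add_mul_I (E η : ℝ) : ((E : ℂ) + η * Complex.I).re = E := by simp

theorem im_ofReal_add_mul_I (E η : ℝ) : ((E : ℂ) + η * Complex.I).im = η := by simp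

/-- Stability of the Marchenko–Pastur equation in the bulk: an approximate solution in the closed
upper half-plane stays away from the real axis. For real `m` the real part of the equation is a
quadratic polynomial with negative discriminant `(E + c - 1)² - 4 c E`; completing the square
leaves only terms that are small with `m.im`. -/
theorem min_le_im_of_selfConsistent {c E η d ρ : ℝ} {m : ℂ} (hc0 : 0 ≤ c) (hc1 : c ≤ 1)
    (hE0 : 0 ≤ E) (hE : E ≤ 5) (hη0 : 0 ≤ η) (hη : η ≤ 1)
    (hd : d ≤ 4 * c * E - (E + c - 1) ^ 2) (hm : 0 ≤ m.im) (hρ : ρ ≤ d / 40)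
    (h : ‖c * (E + η * Complex.I) * m ^ 2 + (E + η * Complex.I + c - 1) * m + 1‖ ≤ ρ) :
    min 1 (d / 216) ≤ m.im := by
  by_contra! hlt
  obtain ⟨h1, h2⟩ := lt_min_iff.1 hlt
  have hρ0 : 0 ≤ ρ := (norm_nonneg _).trans h
  have hre := (Complex.re_le_norm _).trans h
  obtain ⟨α, β⟩ := m
  simp only [Complex.add_re, Complex.mul_re, Complex.ofReal_re, Complex.I_re, Complex.ofReal_im,
    Complex.I_im, Complex.add_im, Complex.mul_im, Complex.sub_re, Complex.sub_im, Complex.one_re,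
    Complex.one_im, pow_two, mul_zero, mul_one, zero_mul, sub_zero, add_zero, zero_add, sub_self]
    at hre hm h1 h2
  set r := c * E * (α * α - β * β) - c * η * (α * β + β * α) + ((E + c - 1) * α - η * β) + 1
    with hr
  have hr2 : r ≤ ρ := by linarith
  -- multiply by `4 c E` and complete the square in `α`
  have hid : 4 * c * E * r = (2 * c * E * α + (E + c - 1) - 2 * c * η * β) ^ 2 +
      (4 * c * E - (E + c - 1) ^ 2) - 4 * c * η * β * (1 - c) -
        4 * c ^ 2 * (η ^ 2 + E ^ 2) * β ^ 2 := by
    rw [hr]; ring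
  have hcE : 0 ≤ c * E := mul_nonneg hc0 hE0
  have hcE5 : c * E ≤ 5 := by nlinarith
  have b1 : 4 * c * E * r ≤ d / 2 := by
    have h3 : c * E * r ≤ c * E * ρ := mul_le_mul_of_nonneg_left hr2 hcE
    have h4 : c * E * ρ ≤ 5 * ρ := mul_le_mul_of_nonneg_right hcE5 hρ0
    linarith
  have b2 : 4 * c * η * β * (1 - c) ≤ 4 * β := by
    have h3 : c * η ≤ 1 := by nlinarith
    have h4 : c * η * (1 - c) ≤ 1 := by nlinarith [mul_nonneg hc0 hη0]
    nlinarith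
  have b3 : 4 * c ^ 2 * (η ^ 2 + E ^ 2) * β ^ 2 ≤ 104 * β := by
    have h3 : c ^ 2 ≤ 1 := pow_le_one₀ hc0 hc1
    have h4 : η ^ 2 + E ^ 2 ≤ 26 := by nlinarith
    have h5 : β ^ 2 ≤ β := by nlinarith
    calc 4 * c ^ 2 * (η ^ 2 + E ^ 2) * β ^ 2 ≤ 4 * 1 * 26 * β := by gcongr
      _ = 104 * β := by ring
  have := sq_nonneg (2 * c * E * α + (E + c - 1) - 2 * c * η * β)
  linarith

/-- All quadratic forms `minorForm X i z` are close to the normalized trace `tr G / N`, with an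
error relative to `1 + Im tr G / N`. -/
def MinorControl {m n : Type*} [Fintype m] [Fintype n] [DecidableEq m]
    [DecidableEq n] (X : Matrix m n ℂ) (N θ : ℝ) (z : ℂ) : Prop :=
  ∀ i, ‖minorForm X i z - (gramResolvent X z).trace / N‖ ≤
    θ * (1 + (gramResolvent X z).trace.im / N)

/-- Once `Im tr G / N` has a positive lower bound `σ`, control of the minors bounds the diagonal
entries of the resolvent of `X Xᴴ`, and the errors that they contribute to the self-consistent
equation. -/
theorem MinorControl.norm_le {m n : Type*} [Fintype m] [Fintype n] [DecidableEq m]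
    [DecidableEq n] {X : Matrix m n ℂ} {N θ σ : ℝ} {z : ℂ} (h : MinorControl X N θ z)
    (hz : 0 < z.im) (hσ : 0 < σ) (hσX : σ ≤ (gramResolvent X z).trace.im / N)
    (hθ0 : 0 ≤ θ) (hθ : θ * (1 + 1 / σ) ≤ 1 / 2) (i : m) :
    ‖z * gramResolvent Xᴴ z i i‖ ≤ 2 / σ ∧
    ‖z * gramResolvent Xᴴ z i i * (minorForm X i z - (gramResolvent X z).trace / N)‖ ≤
      2 * (θ * (1 + 1 / σ)) := by
  set s := (gramResolvent X z).trace / (N : ℂ) with hs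
  set q := minorForm X i z with hq
  set t := (gramResolvent X z).trace.im / N with ht
  have hst : s.im = t := by rw [hs, ht, Complex.div_ofReal_im]
  have ht0 : 0 < t := hσ.trans_le hσX
  have hθt : θ * (1 + t) ≤ t * (θ * (1 + 1 / σ)) := by
    have h1 : 1 ≤ t * (1 / σ) := by rw [mul_one_div, le_div_iff₀ hσ]; linarith
    nlinarith
  have hqs : ‖q - s‖ ≤ θ * (1 + t) := h i
  have hq2 : t / 2 ≤ ‖1 + q‖ := by
    have h1 : (1 + q).im = s.im + (q - s).im := by simp
    have h2 := (abs_le.1 ((Complex.abs_im_le_norm (q - s)).trans hqs)).1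
    have h3 := (le_abs_self _).trans (Complex.abs_im_le_norm (1 + q))
    nlinarith
  have hprod : ‖z * gramResolvent Xᴴ z i i‖ * ‖1 + q‖ = 1 := by
    rw [← norm_mul, mul_gramResolvent_diag_mul X hz i]; simp
  have hR : ‖z * gramResolvent Xᴴ z i i‖ ≤ 2 / t := by
    rw [le_div_iff₀ ht0]
    nlinarith [norm_nonneg (z * gramResolvent Xᴴ z i i)]
  refine ⟨hR.trans (div_le_div_of_nonneg_left (by norm_num) hσ hσX), ?_⟩
  rw [norm_mul]
  calc ‖z * gramResolvent Xᴴ z i i‖ * ‖q - s‖ ≤ 2 / t * (t * (θ * (1 + 1 / σ))) :=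
        mul_le_mul hR (hqs.trans hθt) (norm_nonneg _) (by positivity)
    _ = _ := by field_simp

theorem im_trace_gramResolvent_conjTranspose_le {m n : Type*} [Fintype m] [Fintype n]
    [DecidableEq m] [DecidableEq n] (X : Matrix m n ℂ) {z : ℂ} (hz : 0 < z.im)
    (hmn : Fintype.card m ≤ Fintype.card n) :
    (gramResolvent Xᴴ z).trace.im ≤ (gramResolvent X z).trace.im := by
  have hz0 : z ≠ 0 := fun h => by simp [h] at hz
  have h := mul_trace_gramResolvent_conjTranspose X hz
  have h2 : (gramResolvent Xᴴ z).trace = (gramResolvent X z).trace +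
      (((Fintype.card n : ℝ) - Fintype.card m : ℝ) : ℂ) * z⁻¹ := by
    apply mul_left_cancel₀ hz0
    rw [h]; push_cast; field_simp; ring
  rw [h2, Complex.add_im, Complex.im_ofReal_mul, Complex.inv_im]
  have h3 : (0 : ℝ) ≤ (Fintype.card n : ℝ) - Fintype.card m :=
    sub_nonneg.2 (by exact_mod_cast hmn)
  have h4 : 0 ≤ z.im / Complex.normSq z := div_nonneg hz.le (Complex.normSq_nonneg _)
  have h5 := mul_nonneg h3 h4
  rw [neg_div]
  linarith

/-- `tr G' / p`, with `G'` the resolvent of `X Xᴴ`, solves the Marchenko–Pastur equation of ratio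
`p / n` approximately: sum the Schur complement formula over the rows. -/
theorem MinorControl.norm_selfConsistent_le {p n : ℕ} (hp : 0 < p) (hn : 0 < n)
    {X : Matrix (Fin p) (Fin n) ℂ} {θ σ : ℝ} {z : ℂ} (h : MinorControl X n θ z)
    (hz : 0 < z.im) (hσ : 0 < σ) (hσX : σ ≤ (gramResolvent X z).trace.im / n)
    (hθ0 : 0 ≤ θ) (hθ : θ * (1 + 1 / σ) ≤ 1 / 2) :
    ‖((p / n : ℝ) : ℂ) * z * ((gramResolvent Xᴴ z).trace / p) ^ 2 +
      (z + ((p / n : ℝ) : ℂ) - 1) * ((gramResolvent Xᴴ z).trace / p) + 1‖ ≤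
      2 * (θ * (1 + 1 / σ)) := by
  have hp' : (p : ℂ) ≠ 0 := Nat.cast_ne_zero.2 hp.ne'
  have hn' : (n : ℂ) ≠ 0 := Nat.cast_ne_zero.2 hn.ne'
  have hpr : (0 : ℝ) < p := Nat.cast_pos.2 hp
  set t' := (gramResolvent Xᴴ z).trace with ht'
  set t := (gramResolvent X z).trace with ht
  have htr : z * t' = z * t + n - p := by
    have := mul_trace_gramResolvent_conjTranspose X hz
    simpa using this
  have hsum : z * t' * (1 + t / n) + p =
      - ∑ i, z * gramResolvent Xᴴ z i i * (minorForm X i z - t / n) := by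
    have h1 : ∑ i, z * gramResolvent Xᴴ z i i * (minorForm X i z - t / n) =
        ∑ i, (-1 - z * gramResolvent Xᴴ z i i * (1 + t / n)) := by
      refine Finset.sum_congr rfl fun i _ => ?_
      rw [← mul_gramResolvent_diag_mul X hz i]; ring
    rw [h1, Finset.sum_sub_distrib, ← Finset.sum_mul, ← Finset.mul_sum]
    have h2 : ∑ i, gramResolvent Xᴴ z i i = t' := rfl
    rw [h2]; simp
  have hexpr : ((p / n : ℝ) : ℂ) * z * (t' / p) ^ 2 + (z + ((p / n : ℝ) : ℂ) - 1) * (t' / p) + 1 =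
      (z * t' * (1 + t / n) + p) / p := by
    have h3 : z * t = z * t' - n + p := by rw [htr]; ring
    have h4 : z * t' * (1 + t / n) = t' * (z + z * t / n) := by ring
    rw [h4, h3]
    push_cast; field_simp; ring
  rw [hexpr, hsum, norm_div, norm_neg, Complex.norm_natCast, div_le_iff₀ hpr]
  refine (norm_sum_le _ _).trans ((Finset.sum_le_sum fun i _ =>
    (h.norm_le hz hσ hσX hθ0 hθ i).2).trans_eq ?_)
  simp; ring

/-- The lower bound on the density of eigenvalues descends from scale `1` to scale `2⁻ᵏ`: passing to
half the scale loses a factor `2`, and the self-consistent equation restores it. -/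
theorem le_im_trace_gramResolvent_of_minorControl {p n : ℕ} (hp : 0 < p) (hpn : p ≤ n)
    {X : Matrix (Fin p) (Fin n) ℂ} {E d θ σ : ℝ} (hE0 : 0 ≤ E) (hE : E ≤ 5)
    (hd0 : 0 < d) (hd : d ≤ 4 * (p / n : ℝ) * E - (E + (p / n : ℝ) - 1) ^ 2)
    (hX : ∑ i, ∑ j, ‖X i j‖ ^ 2 ≤ 2 * (p : ℝ))
    (hσ : 0 < σ) (hσ1 : σ ≤ (p / n : ℝ) * min (1 / 52) (d / 216) / 2)
    (hθ0 : 0 ≤ θ) (hθ1 : θ * (1 + 1 / σ) ≤ 1 / 2) (hθ2 : 2 * (θ * (1 + 1 / σ)) ≤ d / 40)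
    (k : ℕ) (h : ∀ j ≤ k, MinorControl X n θ (E + ((1 / 2 : ℝ) ^ j : ℝ) * Complex.I)) :
    min (1 / 52) (d / 216) ≤
      (gramResolvent Xᴴ (E + ((1 / 2 : ℝ) ^ k : ℝ) * Complex.I)).trace.im / p := by
  have hn : 0 < n := hp.trans_le hpn
  have hpr : (0 : ℝ) < p := Nat.cast_pos.2 hp
  have hnr : (0 : ℝ) < n := Nat.cast_pos.2 hn
  have him : ∀ j : ℕ, 0 < ((E : ℂ) + ((1 / 2 : ℝ) ^ j : ℝ) * Complex.I).im := fun j => by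
    have : (0 : ℝ) < (1 / 2 : ℝ) ^ j := by positivity
    rwa [im_ofReal_add_mul_I]
  set κ := min (1 / 52 : ℝ) (d / 216) with hκ
  have hκ0 : 0 < κ := lt_min (by norm_num) (by positivity)
  -- a crude lower bound at one scale improves itself through the self-consistent equation
  have improve : ∀ j ≤ k,
      κ / 2 ≤ (gramResolvent Xᴴ (E + ((1 / 2 : ℝ) ^ j : ℝ) * Complex.I)).trace.im / p →
      κ ≤ (gramResolvent Xᴴ (E + ((1 / 2 : ℝ) ^ j : ℝ) * Complex.I)).trace.im / p := by
    intro j hj hlow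
    set z : ℂ := E + ((1 / 2 : ℝ) ^ j : ℝ) * Complex.I with hz
    have hσX : σ ≤ (gramResolvent X z).trace.im / n := by
      have h1 : (gramResolvent Xᴴ z).trace.im ≤ (gramResolvent X z).trace.im :=
        im_trace_gramResolvent_conjTranspose_le X (him j) (by simpa using hpn)
      calc σ ≤ (p / n : ℝ) * (κ / 2) := by linarith
        _ ≤ (p / n : ℝ) * ((gramResolvent Xᴴ z).trace.im / p) := by gcongr
        _ = (gramResolvent Xᴴ z).trace.im / n := by field_simp
        _ ≤ _ := by gcongr
    have hsc := (h j hj).norm_selfConsistent_le hp hn (him j) hσ hσX hθ0 hθ1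
    have him' : ((gramResolvent Xᴴ z).trace / (p : ℂ)).im = (gramResolvent Xᴴ z).trace.im / p :=
      Complex.div_natCast_im _ _
    have hst := min_le_im_of_selfConsistent (E := E) (η := (1 / 2 : ℝ) ^ j)
      (m := (gramResolvent Xᴴ z).trace / p) (by positivity)
      ((div_le_one hnr).2 (by exact_mod_cast hpn)) hE0 hE (by positivity)
      (pow_le_one₀ (by norm_num) (by norm_num)) hd
      (by rw [him']; linarith) hθ2 hsc
    rw [him'] at hst
    refine le_trans (min_le_min_right _ (by norm_num)) hst
  induction k with
  | zero =>
    refine improve 0 le_rfl ?_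
    have h0 := card_div_le_im_trace_gramResolvent Xᴴ hE0 hE (by
      rw [Finset.sum_comm]; simpa using hX)
    rw [Fintype.card_fin] at h0
    rw [pow_zero, le_div_iff₀ hpr]
    have : κ ≤ 1 / 52 := min_le_left _ _
    refine le_trans ?_ h0
    nlinarith
  | succ k ih =>
    have h1 := ih (fun j hj => h j (hj.trans k.le_succ)) fun j hj => improve j (hj.trans k.le_succ)
    refine improve (k + 1) le_rfl ?_
    have h2 := half_im_trace_gramResolvent_le Xᴴ E (η := (1 / 2 : ℝ) ^ k) (by positivity)
    rw [show (1 / 2 : ℝ) ^ (k + 1) = (1 / 2 : ℝ) ^ k / 2 by ring]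
    calc κ / 2 ≤ (gramResolvent Xᴴ (E + ((1 / 2 : ℝ) ^ k : ℝ) * Complex.I)).trace.im / p / 2 := by
          gcongr
      _ = (gramResolvent Xᴴ (E + ((1 / 2 : ℝ) ^ k : ℝ) * Complex.I)).trace.im / 2 / p := by ring
      _ ≤ _ := by gcongr

theorem norm_gramResolvent_diag_le_of_minorControl {p n : ℕ} (hp : 0 < p) (hpn : p ≤ n)
    {X : Matrix (Fin p) (Fin n) ℂ} {E d θ σ : ℝ} (hE0 : 0 ≤ E) (hE : E ≤ 5)
    (hd0 : 0 < d) (hd : d ≤ 4 * (p / n : ℝ) * E - (E + (p / n : ℝ) - 1) ^ 2)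
    (hX : ∑ i, ∑ j, ‖X i j‖ ^ 2 ≤ 2 * (p : ℝ))
    (hσ : 0 < σ) (hσ1 : σ ≤ (p / n : ℝ) * min (1 / 52) (d / 216) / 2)
    (hθ0 : 0 ≤ θ) (hθ1 : θ * (1 + 1 / σ) ≤ 1 / 2) (hθ2 : 2 * (θ * (1 + 1 / σ)) ≤ d / 40)
    (k : ℕ) (h : ∀ j ≤ k, MinorControl X n θ (E + ((1 / 2 : ℝ) ^ j : ℝ) * Complex.I))
    (h' : MinorControl Xᴴ n θ (E + ((1 / 2 : ℝ) ^ k : ℝ) * Complex.I)) :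
    (∀ i, E * ‖gramResolvent Xᴴ (E + ((1 / 2 : ℝ) ^ k : ℝ) * Complex.I) i i‖ ≤ 2 / σ) ∧
    ∀ j, E * ‖gramResolvent X (E + ((1 / 2 : ℝ) ^ k : ℝ) * Complex.I) j j‖ ≤ 2 / σ := by
  have hlow := le_im_trace_gramResolvent_of_minorControl hp hpn hE0 hE hd0 hd hX hσ hσ1 hθ0 hθ1
    hθ2 k h
  have hpr : (0 : ℝ) < p := Nat.cast_pos.2 hp
  have hnr : (0 : ℝ) < n := Nat.cast_pos.2 (hp.trans_le hpn)
  have hη : (0 : ℝ) < (1 / 2 : ℝ) ^ k := by positivity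
  have hk := h k le_rfl
  set z : ℂ := E + ((1 / 2 : ℝ) ^ k : ℝ) * Complex.I with hz
  have hzim : 0 < z.im := by rwa [hz, im_ofReal_add_mul_I]
  have hzE : E ≤ ‖z‖ := by
    have := Complex.re_le_norm z
    rwa [hz, re_ofReal_add_mul_I] at this
  have hκ0 : 0 < min (1 / 52 : ℝ) (d / 216) := lt_min (by norm_num) (by positivity)
  have hσ' : σ ≤ (gramResolvent Xᴴ z).trace.im / n := by
    calc σ ≤ (p / n : ℝ) * min (1 / 52) (d / 216) := by
          have : 0 ≤ (p / n : ℝ) * min (1 / 52) (d / 216) := by positivity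
          linarith
      _ ≤ (p / n : ℝ) * ((gramResolvent Xᴴ z).trace.im / p) := by gcongr
      _ = _ := by field_simp
  have hσ'' : σ ≤ (gramResolvent X z).trace.im / n := hσ'.trans (by
    gcongr
    exact im_trace_gramResolvent_conjTranspose_le X hzim (by simpa using hpn))
  refine ⟨fun i => ?_, fun j => ?_⟩
  · refine le_trans ?_ (hk.norm_le hzim hσ hσ'' hθ0 hθ1 i).1
    rw [norm_mul]
    gcongr
  · have := (h'.norm_le hzim hσ hσ' hθ0 hθ1 j).1
    rw [Matrix.conjTranspose_conjTranspose] at this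
    refine le_trans ?_ this
    rw [norm_mul]
    gcongr

/-! ### Quadratic forms of the rows with the resolvents of the minors -/

/-- Used for the measurability of the resolvents of random matrices. -/
theorem continuous_gramResolvent_apply {m n : Type*} [Fintype m] [Fintype n] [DecidableEq n]
    {z : ℂ} (hz : 0 < z.im) (k l : n) :
    Continuous fun X : Matrix m n ℂ => gramResolvent X z k l := by
  have hc : Continuous fun X : Matrix m n ℂ => Xᴴ * X - z • (1 : Matrix n n ℂ) := by fun_prop
  have hdet : ∀ X : Matrix m n ℂ, (Xᴴ * X - z • (1 : Matrix n n ℂ)).det ≠ 0 := fun X =>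
    (Matrix.isUnit_det_of_right_inverse (sub_mul_gramResolvent X hz)).ne_zero
  have h : (fun X : Matrix m n ℂ => gramResolvent X z k l) = fun X =>
      ((Xᴴ * X - z • (1 : Matrix n n ℂ)).det)⁻¹ *
        (Xᴴ * X - z • (1 : Matrix n n ℂ)).adjugate k l := by
    funext X
    rw [gramResolvent, Matrix.inv_def, Ring.inverse_eq_inv]
    rfl
  rw [h]
  exact (hc.matrix_det.inv₀ hdet).mul (hc.matrix_adjugate.matrix_elem k l)

theorem IsBoundedStandard.precomp {Ω ι κ : Type*} [MeasurableSpace Ω] {P : Measure Ω}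
    {x : ι → Ω → ℂ} {K : ℝ} (hx : IsBoundedStandard P x K) {f : κ → ι}
    (hf : Function.Injective f) : IsBoundedStandard P (fun k => x (f k)) K :=
  ⟨fun _ => hx.measurable _, hx.indep.precomp hf, fun _ => hx.bound _, fun _ => hx.mean _,
    fun _ => hx.second _⟩

theorem IsBoundedStandard.conj {Ω ι : Type*} [MeasurableSpace Ω] {P : Measure Ω}
    {x : ι → Ω → ℂ} {K : ℝ} (hx : IsBoundedStandard P x K) :
    IsBoundedStandard P (fun i ω => star (x i ω)) K where
  measurable i := Complex.continuous_conj.measurable.comp (hx.measurable i)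
  indep := hx.indep.comp (fun _ w => (starRingEnd ℂ) w) fun _ => Complex.continuous_conj.measurable
  bound i := by simpa using hx.bound i
  mean i := by
    have := integral_conj (μ := P) (f := x i)
    rw [hx.mean i, map_zero] at this
    exact this
  second i := by simpa using hx.second i

/-- A row of the random matrix is independent of the resolvent of the matrix without that row. -/
theorem indepFun_row_gramResolvent {Ω : Type*} [MeasurableSpace Ω] {P : Measure Ω}
    {a b : ℕ} {M : Ω → Matrix (Fin a) (Fin b) ℂ}
    (hm : ∀ t : Fin a × Fin b, Measurable fun ω => M ω t.1 t.2)
    (hind : iIndepFun (fun (t : Fin a × Fin b) ω => M ω t.1 t.2) P) (i : Fin a) (s : ℂ) {z : ℂ}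
    (hz : 0 < z.im) :
    Measurable (fun ω (k l : Fin b) => gramResolvent ((s • M ω).updateRow i 0) z k l) ∧
    IndepFun (fun ω j => M ω i j)
      (fun ω (k l : Fin b) => gramResolvent ((s • M ω).updateRow i 0) z k l) P := by
  classical
  let J : Finset (Fin a × Fin b) := Finset.univ.filter fun t => ¬ t.1 = i
  let rest : Ω → Fin a × Fin b → ℂ := fun ω t => if t ∈ J then M ω t.1 t.2 else 0
  let g : (Fin a × Fin b → ℂ) → Fin b → Fin b → ℂ := fun u k l =>
    gramResolvent (s • Matrix.of fun i j => u (i, j)) z k l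
  have hg : Measurable g := by
    refine measurable_pi_lambda _ fun k => measurable_pi_lambda _ fun l => ?_
    refine ((continuous_gramResolvent_apply hz k l).comp ?_).measurable
    refine Continuous.const_smul ?_ s
    exact continuous_matrix fun i j => continuous_apply (i, j)
  have hrest : Measurable rest := by
    refine measurable_pi_lambda _ fun t => ?_
    by_cases ht : t ∈ J
    · simpa only [rest, ht, if_true] using hm t
    · simp only [rest, ht, if_false]; exact measurable_const
  have hgr : (fun ω (k l : Fin b) => gramResolvent ((s • M ω).updateRow i 0) z k l) =
      g ∘ rest := by
    funext ω k l
    have : (s • M ω).updateRow i 0 = s • Matrix.of fun i j => rest ω (i, j) := by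
      ext c j
      by_cases hc : c = i
      · subst hc; simp [rest, J]
      · simp [rest, J, hc]
    simp only [Function.comp, g, this]
  rw [hgr]
  refine ⟨hg.comp hrest, ?_⟩
  have h := indepFun_ite_mem hm hind (I := Finset.univ.filter fun t => t.1 = i) (J := J)
    (Finset.disjoint_filter_filter_not _ _ _)
  have h2 := h.comp (φ := fun (u : Fin a × Fin b → ℂ) (j : Fin b) => u (i, j))
    (measurable_pi_lambda _ fun j => measurable_pi_apply (i, j)) hg
  convert h2 using 1
  funext ω j
  simp

/-- Converts the concentration bound for the quadratic form, centred at the trace of the resolvent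
of the minor, into a bound relative to the trace of the full resolvent. The Ward identity
turns the Frobenius norm into an imaginary part; `w` stands for `Λ K / √(N Im z)`. -/
theorem norm_minorForm_sub_le {m n : Type*} [Fintype m] [Fintype n] [DecidableEq m]
    [DecidableEq n] (X : Matrix m n ℂ) {z : ℂ} (hz : 0 < z.im) (i : m) {N Λ K w : ℝ}
    (hN : 0 < N) (hNz : 1 ≤ N * z.im) (hK : 1 ≤ K) (hΛ : 1 ≤ Λ) (hw0 : 0 ≤ w) (hw1 : w ≤ 1)
    (hw : Λ ^ 2 * K ^ 2 ≤ w ^ 2 * (N * z.im))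
    (h : ‖minorForm X i z - (gramResolvent (X.updateRow i 0) z).trace / N‖ ≤
      Λ * (K * √(∑ k, ∑ l, ‖gramResolvent (X.updateRow i 0) z k l‖ ^ 2) +
        K ^ 2 * (z.im)⁻¹) / N) :
    ‖minorForm X i z - (gramResolvent X z).trace / N‖ ≤
      3 * w * (1 + (gramResolvent X z).trace.im / N) := by
  set t := (gramResolvent X z).trace.im / N with ht
  set η := z.im with hη
  have ht0 : 0 ≤ t := by
    refine div_nonneg ?_ hN.le
    rw [im_trace_gramResolvent X hz]
    exact mul_nonneg hz.le (Finset.sum_nonneg fun i _ => Finset.sum_nonneg fun j _ => sq_nonneg _)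
  have hdiff := norm_trace_gramResolvent_sub_le X hz i
  have hF : ∑ k, ∑ l, ‖gramResolvent (X.updateRow i 0) z k l‖ ^ 2 ≤ N * (1 + t) / η := by
    rw [le_div_iff₀ hz, mul_comm, ← im_trace_gramResolvent _ hz]
    have h1 := (le_abs_self _).trans ((Complex.abs_im_le_norm _).trans hdiff)
    rw [Complex.sub_im] at h1
    have h2 : (gramResolvent X z).trace.im = N * t := by rw [ht]; field_simp
    have h3 : η⁻¹ ≤ N := by rw [inv_le_iff_one_le_mul₀ hz]; exact hNz
    nlinarith
  have hΛ0 : 0 < Λ := by linarith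
  have hK0 : 0 < K := by linarith
  have hNη : 0 < N * η := by positivity
  have hA : Λ * (K * √(∑ k, ∑ l, ‖gramResolvent (X.updateRow i 0) z k l‖ ^ 2)) / N ≤
      w * (1 + t) := by
    rw [div_le_iff₀ hN]
    calc Λ * (K * √(∑ k, ∑ l, ‖gramResolvent (X.updateRow i 0) z k l‖ ^ 2))
        ≤ Λ * (K * √(N * (1 + t) / η)) := by gcongr
      _ = √(Λ ^ 2 * K ^ 2 * (N * (1 + t) / η)) := by
          rw [Real.sqrt_mul (by positivity), ← mul_pow, Real.sqrt_sq (by positivity)]; ring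
      _ ≤ √((w * (1 + t) * N) ^ 2) := by
          refine Real.sqrt_le_sqrt ?_
          calc Λ ^ 2 * K ^ 2 * (N * (1 + t) / η) ≤ w ^ 2 * (N * η) * (N * (1 + t) / η) := by
                gcongr
            _ = w ^ 2 * N ^ 2 * (1 + t) := by field_simp
            _ ≤ w ^ 2 * N ^ 2 * ((1 + t) * (1 + t)) := by
                gcongr
                nlinarith
            _ = _ := by ring
      _ = _ := Real.sqrt_sq (by positivity)
  have hww : w ^ 2 ≤ w := by nlinarith
  have hB : Λ * (K ^ 2 * η⁻¹) / N ≤ w := by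
    have e : Λ * (K ^ 2 * η⁻¹) / N = Λ * K ^ 2 / (N * η) := by field_simp
    rw [e, div_le_iff₀ hNη]
    calc Λ * K ^ 2 ≤ Λ ^ 2 * K ^ 2 := by gcongr; nlinarith
      _ ≤ w ^ 2 * (N * η) := hw
      _ ≤ w * (N * η) := by gcongr
  have hC : η⁻¹ / N ≤ w := by
    have e : η⁻¹ / N = 1 / (N * η) := by field_simp
    rw [e, div_le_iff₀ hNη]
    calc (1 : ℝ) ≤ Λ ^ 2 * K ^ 2 := by nlinarith [one_le_pow₀ (n := 2) hΛ, one_le_pow₀ (n := 2) hK]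
      _ ≤ w ^ 2 * (N * η) := hw
      _ ≤ w * (N * η) := by gcongr
  have hsplit : minorForm X i z - (gramResolvent X z).trace / N =
      (minorForm X i z - (gramResolvent (X.updateRow i 0) z).trace / N) +
      ((gramResolvent (X.updateRow i 0) z).trace - (gramResolvent X z).trace) / N := by ring
  have hD : ‖((gramResolvent (X.updateRow i 0) z).trace - (gramResolvent X z).trace) / (N : ℂ)‖ ≤
      w := by
    rw [norm_div, Complex.norm_real, Real.norm_eq_abs, abs_of_pos hN]
    exact (div_le_div_of_nonneg_right hdiff hN.le).trans hC
  rw [hsplit]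
  refine (norm_add_le _ _).trans ?_
  rw [mul_add, add_div] at h
  nlinarith [mul_nonneg hw0 ht0]

theorem IsBoundedStandard.measure_not_minorControl_le {Ω : Type*} [MeasurableSpace Ω]
    {P : Measure Ω} [IsProbabilityMeasure P] {a b m : ℕ} (hb : b ≤ 2 ^ m)
    {M : Ω → Matrix (Fin a) (Fin b) ℂ} {K : ℝ}
    (hM : IsBoundedStandard P (fun (t : Fin a × Fin b) ω => M ω t.1 t.2) K) (hK : 1 ≤ K)
    {z : ℂ} (hz : 0 < z.im) {N L w : ℝ} (hL : 1 ≤ L)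
    (hN : 0 < N) (hNz : 1 ≤ N * z.im) (hw0 : 0 ≤ w) (hw1 : w ≤ 1)
    (hw : ((8 * m + 2) * L ^ 2) ^ 2 * K ^ 2 ≤ w ^ 2 * (N * z.im)) :
    P {ω | ¬ MinorControl ((((√N)⁻¹ : ℝ) : ℂ) • M ω) N (3 * w) z} ≤
      (a * (8 * m * (b + 1) + 4)) * ENNReal.ofReal (Real.exp (1 - L)) := by
  set s : ℂ := (((√N)⁻¹ : ℝ) : ℂ) with hs
  have hss : s * (starRingEnd ℂ) s = (N : ℂ)⁻¹ := by
    rw [hs, Complex.conj_ofReal, ← Complex.ofReal_mul, ← mul_inv, Real.mul_self_sqrt hN.le,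
      Complex.ofReal_inv]
  have hΛ : 1 ≤ (8 * m + 2) * L ^ 2 := by
    have : 1 ≤ L ^ 2 := one_le_pow₀ hL
    have hm0 : (0 : ℝ) ≤ m := Nat.cast_nonneg m
    nlinarith
  let bad : Fin a → Set Ω := fun i =>
    {ω | (∀ k, ∑ l, ‖gramResolvent ((s • M ω).updateRow i 0) z k l‖ ^ 2 ≤ (z.im)⁻¹ ^ 2) ∧
        (8 * m + 2) * L ^ 2 *
          (K * √(∑ k, ∑ l, ‖gramResolvent ((s • M ω).updateRow i 0) z k l‖ ^ 2) +
            K ^ 2 * (z.im)⁻¹) <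
        ‖(∑ k, ∑ l, M ω i k * gramResolvent ((s • M ω).updateRow i 0) z k l *
          (starRingEnd ℂ) (M ω i l)) - ∑ k, gramResolvent ((s • M ω).updateRow i 0) z k k‖}
  have hbad : ∀ i, P (bad i) ≤ (8 * m * (b + 1) + 4) * ENNReal.ofReal (Real.exp (1 - L)) := by
    intro i
    obtain ⟨h1, h2⟩ := indepFun_row_gramResolvent hM.measurable hM.indep i s hz
    have hrow : IsBoundedStandard P (fun j ω => M ω i j) K :=
      hM.precomp (f := fun j => (i, j)) fun j k h => (Prod.mk.inj h).2
    exact hrow.measure_indep_quadratic_gt_le hb hK h1 h2 (inv_nonneg.2 hz.le) hL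
  calc P {ω | ¬ MinorControl (s • M ω) N (3 * w) z} ≤ P (⋃ i, bad i) := by
        refine measure_mono fun ω hω => ?_
        by_contra hgood
        simp only [Set.mem_iUnion, not_exists] at hgood
        refine hω fun i => norm_minorForm_sub_le (s • M ω) hz i hN hNz hK hΛ hw0 hw1 hw ?_
        have h1 : ¬ _ := fun h => hgood i
          ⟨fun k => sum_norm_sq_gramResolvent_le ((s • M ω).updateRow i 0) hz k, h⟩
        rw [not_lt] at h1
        set G := gramResolvent ((s • M ω).updateRow i 0) z with hG
        have h2 : minorForm (s • M ω) i z - G.trace / N =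
            ((∑ k, ∑ l, M ω i k * G k l * (starRingEnd ℂ) (M ω i l)) - ∑ k, G k k) * (N : ℂ)⁻¹ := by
          rw [sub_mul, div_eq_mul_inv]
          congr 1
          rw [← hss, Finset.sum_mul]
          simp only [minorForm, dotProduct, Matrix.mulVec, Finset.mul_sum, Finset.sum_mul]
          refine Finset.sum_congr rfl fun k _ => Finset.sum_congr rfl fun l _ => ?_
          simp only [Matrix.smul_apply, Pi.star_apply, smul_eq_mul, star_mul']
          rw [← hG]
          simp only [RCLike.star_def]
          ring
        rw [h2, norm_mul, norm_inv, Complex.norm_real, Real.norm_eq_abs, abs_of_pos hN,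
          ← div_eq_mul_inv]
        exact div_le_div_of_nonneg_right h1 hN.le
    _ ≤ ∑ i, P (bad i) := measure_iUnion_fintype_le _ _
    _ ≤ ∑ _i : Fin a, (8 * m * (b + 1) + 4) * ENNReal.ofReal (Real.exp (1 - L)) :=
        Finset.sum_le_sum fun i _ => hbad i
    _ = _ := by
        rw [Finset.sum_const, Finset.card_univ, Fintype.card_fin, nsmul_eq_mul]
        exact (mul_assoc _ _ _).symm

theorem IsBoundedStandard.measure_frobenius_gt_le {Ω : Type*} [MeasurableSpace Ω]
    {P : Measure Ω} [IsProbabilityMeasure P] {a b : ℕ}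
    {M : Ω → Matrix (Fin a) (Fin b) ℂ} {K : ℝ}
    (hM : IsBoundedStandard P (fun (t : Fin a × Fin b) ω => M ω t.1 t.2) K) (hK : 1 ≤ K)
    {L : ℝ} (hb : 0 < b) (hL : 2 * L * (K * √b + K ^ 2) ≤ b) :
    P {ω | ¬ ∑ i, ∑ j, ‖((((√b)⁻¹ : ℝ) : ℂ) • M ω) i j‖ ^ 2 ≤ 2 * (a : ℝ)} ≤
      (a * 4) * ENNReal.ofReal (Real.exp (1 - L)) := by
  have hbr : (0 : ℝ) < b := Nat.cast_pos.2 hb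
  let bad : Fin a → Set Ω := fun i => {ω | 2 * L * (K * √b + K ^ 2 * 1) <
    ‖(∑ j, M ω i j * 1 * (starRingEnd ℂ) (M ω i j)) - ∑ _j : Fin b, (1 : ℂ)‖}
  have hbad : ∀ i, P (bad i) ≤ 4 * ENNReal.ofReal (Real.exp (1 - L)) := by
    intro i
    have hrow : IsBoundedStandard P (fun j ω => M ω i j) K :=
      hM.precomp (f := fun j => (i, j)) fun j k h => (Prod.mk.inj h).2
    exact hrow.measure_diagonal_gt_le hK (a := fun _ => 1) zero_le_one (Real.sqrt_nonneg b)
      (by simp) (by simp) L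
  calc _ ≤ P (⋃ i, bad i) := by
        refine measure_mono fun ω hω => ?_
        by_contra hgood
        simp only [Set.mem_iUnion, not_exists] at hgood
        refine hω ?_
        have hrow : ∀ i, ∑ j, ‖((((√b)⁻¹ : ℝ) : ℂ) • M ω) i j‖ ^ 2 ≤ 2 := fun i => by
          have h1 : ¬ _ := hgood i
          simp only [bad, Set.mem_ofPred_eq, not_lt, mul_one, Complex.mul_conj'] at h1
          have h2 : (∑ j, (‖M ω i j‖ : ℂ) ^ 2) - ∑ _j : Fin b, (1 : ℂ) =
              (((∑ j, ‖M ω i j‖ ^ 2) - b : ℝ) : ℂ) := by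
            push_cast; simp
          rw [h2, Complex.norm_real, Real.norm_eq_abs] at h1
          have h3 := (le_abs_self _).trans (h1.trans hL)
          have h4 : ∑ j, ‖((((√b)⁻¹ : ℝ) : ℂ) • M ω) i j‖ ^ 2 = (b : ℝ)⁻¹ * ∑ j, ‖M ω i j‖ ^ 2 := by
            rw [Finset.mul_sum]
            refine Finset.sum_congr rfl fun j _ => ?_
            rw [Matrix.smul_apply, smul_eq_mul, norm_mul, mul_pow, Complex.norm_real,
              Real.norm_eq_abs, sq_abs, inv_pow, Real.sq_sqrt hbr.le]
          rw [h4, inv_mul_le_iff₀ hbr]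
          linarith
        refine (Finset.sum_le_sum fun i _ => hrow i).trans_eq ?_
        simp [mul_comm]
    _ ≤ ∑ i, P (bad i) := measure_iUnion_fintype_le _ _
    _ ≤ ∑ _i : Fin a, 4 * ENNReal.ofReal (Real.exp (1 - L)) :=
        Finset.sum_le_sum fun i _ => hbad i
    _ = _ := by
        rw [Finset.sum_const, Finset.card_univ, Fintype.card_fin, nsmul_eq_mul, mul_assoc]

/-! ### From regularity of the resolvent to delocalization -/

/-- The regularity of `X` from which delocalization follows deterministically: a bound on the
Frobenius norm, and control of the minors of `X` and of `Xᴴ` at all points `l / n + 2⁻ʲ i` with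
`l ≤ 5 n` and `j ≤ k`. -/
structure IsLocallyRegular {p n : ℕ} (X : Matrix (Fin p) (Fin n) ℂ) (θ : ℝ) (k : ℕ) : Prop where
  frobenius : ∑ i, ∑ j, ‖X i j‖ ^ 2 ≤ 2 * (p : ℝ)
  row : ∀ l < 5 * n + 1, ∀ j ≤ k,
    MinorControl X n θ (((l / n : ℝ) : ℂ) + ((1 / 2 : ℝ) ^ j : ℝ) * Complex.I)
  col : ∀ l < 5 * n + 1, ∀ j ≤ k,
    MinorControl Xᴴ n θ (((l / n : ℝ) : ℂ) + ((1 / 2 : ℝ) ^ j : ℝ) * Complex.I)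

theorem IsBoundedStandard.measure_not_isLocallyRegular_le {Ω : Type*} [MeasurableSpace Ω]
    {P : Measure Ω} [IsProbabilityMeasure P] {p n m k : ℕ} (hn : 0 < n) (hpn : p ≤ n)
    (hm : n ≤ 2 ^ m) (hmn : m ≤ n) (hkn : k < n)
    {M : Ω → Matrix (Fin p) (Fin n) ℂ} {K : ℝ}
    (hM : IsBoundedStandard P (fun (t : Fin p × Fin n) ω => M ω t.1 t.2) K) (hK : 1 ≤ K)
    {L w : ℝ} (hL : 1 ≤ L) (hk : 1 ≤ n * (1 / 2 : ℝ) ^ k) (hw0 : 0 ≤ w) (hw1 : w ≤ 1)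
    (hw : ((8 * m + 2) * L ^ 2) ^ 2 * K ^ 2 ≤ w ^ 2 * (n * (1 / 2 : ℝ) ^ k))
    (hLn : 2 * L * (K * √n + K ^ 2) ≤ n) :
    P {ω | ¬ IsLocallyRegular ((((√n)⁻¹ : ℝ) : ℂ) • M ω) (3 * w) k} ≤
      ENNReal.ofReal (300 * (n : ℝ) ^ 5 * Real.exp (1 - L)) := by
  have hnr : (0 : ℝ) < n := Nat.cast_pos.2 hn
  set e := ENNReal.ofReal (Real.exp (1 - L)) with he
  let X : Ω → Matrix (Fin p) (Fin n) ℂ := fun ω => (((√n)⁻¹ : ℝ) : ℂ) • M ω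
  let z : ℕ → ℕ → ℂ := fun l j => ((l / n : ℝ) : ℂ) + ((1 / 2 : ℝ) ^ j : ℝ) * Complex.I
  have hzim : ∀ l j, (z l j).im = (1 / 2 : ℝ) ^ j := fun l j => im_ofReal_add_mul_I _ _
  have hz0 : ∀ l j, 0 < (z l j).im := fun l j => by rw [hzim]; positivity
  have hmono : ∀ j ≤ k, (n : ℝ) * (1 / 2 : ℝ) ^ k ≤ n * (1 / 2 : ℝ) ^ j := fun j hj =>
    mul_le_mul_of_nonneg_left (pow_le_pow_of_le_one (by norm_num) (by norm_num) hj) hnr.le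
  have hrow : ∀ l, ∀ j ≤ k, P {ω | ¬ MinorControl (X ω) n (3 * w) (z l j)} ≤
      (p * (8 * m * (n + 1) + 4)) * e := fun l j hj =>
    hM.measure_not_minorControl_le hm hK (hz0 l j) hL hnr
      (by rw [hzim]; exact hk.trans (hmono j hj)) hw0 hw1
      (by rw [hzim]; exact hw.trans (mul_le_mul_of_nonneg_left (hmono j hj) (sq_nonneg _)))
  have hMH : IsBoundedStandard P (fun (t : Fin n × Fin p) ω => (M ω)ᴴ t.1 t.2) K :=
    (hM.precomp (f := Prod.swap) Prod.swap_injective).conj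
  have hcol : ∀ l, ∀ j ≤ k, P {ω | ¬ MinorControl (X ω)ᴴ n (3 * w) (z l j)} ≤
      (n * (8 * m * (p + 1) + 4)) * e := fun l j hj => by
    have h := hMH.measure_not_minorControl_le (hpn.trans hm) hK (hz0 l j) hL hnr
      (by rw [hzim]; exact hk.trans (hmono j hj)) hw0 hw1
      (by rw [hzim]; exact hw.trans (mul_le_mul_of_nonneg_left (hmono j hj) (sq_nonneg _)))
    have hX : ∀ ω, (X ω)ᴴ = (((√n)⁻¹ : ℝ) : ℂ) • (M ω)ᴴ := fun ω => by
      rw [Matrix.conjTranspose_smul, RCLike.star_def, Complex.conj_ofReal]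
    simpa only [hX] using h
  have hfro := hM.measure_frobenius_gt_le hK hn hLn
  have hcount : p * 4 + (5 * n + 1) * ((k + 1) * (p * (8 * m * (n + 1) + 4) +
      n * (8 * m * (p + 1) + 4))) ≤ 300 * n ^ 5 := by
    have h1 : ∀ a ≤ n, 8 * m * (a + 1) + 4 ≤ 20 * n ^ 2 := fun a ha => by
      have : m * (a + 1) ≤ n * (2 * n) := Nat.mul_le_mul hmn (by omega)
      nlinarith
    calc _ ≤ n * 4 + (6 * n) * (n * (n * (20 * n ^ 2) + n * (20 * n ^ 2))) := by
          gcongr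
          · omega
          · omega
          · exact h1 n le_rfl
          · exact h1 p hpn
      _ = 4 * n + 240 * n ^ 5 := by ring
      _ ≤ 300 * n ^ 5 := by
          have : n ≤ n ^ 5 := Nat.le_self_pow (by norm_num) n
          omega
  calc _ ≤ P ({ω | ¬ ∑ i, ∑ j, ‖X ω i j‖ ^ 2 ≤ 2 * (p : ℝ)} ∪
        ⋃ (l : Fin (5 * n + 1)), ⋃ (j : Fin (k + 1)),
          ({ω | ¬ MinorControl (X ω) n (3 * w) (z l j)} ∪
           {ω | ¬ MinorControl (X ω)ᴴ n (3 * w) (z l j)})) := by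
        refine measure_mono fun ω hω => ?_
        by_contra h
        simp only [Set.mem_union, Set.mem_iUnion, Set.mem_ofPred_eq, not_or, not_exists,
          not_not] at h
        exact hω ⟨h.1, fun l hl j hj => (h.2 ⟨l, hl⟩ ⟨j, Nat.lt_succ_of_le hj⟩).1,
          fun l hl j hj => (h.2 ⟨l, hl⟩ ⟨j, Nat.lt_succ_of_le hj⟩).2⟩
    _ ≤ (p * 4) * e + ∑ _l : Fin (5 * n + 1), ∑ _j : Fin (k + 1),
          ((p * (8 * m * (n + 1) + 4)) * e + (n * (8 * m * (p + 1) + 4)) * e) := by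
        refine (measure_union_le _ _).trans (add_le_add hfro ?_)
        refine (measure_iUnion_fintype_le _ _).trans (Finset.sum_le_sum fun l _ => ?_)
        refine (measure_iUnion_fintype_le _ _).trans (Finset.sum_le_sum fun j _ => ?_)
        exact (measure_union_le _ _).trans
          (add_le_add (hrow l j (Nat.le_of_lt_succ j.2)) (hcol l j (Nat.le_of_lt_succ j.2)))
    _ = ((p * 4 + (5 * n + 1) * ((k + 1) * (p * (8 * m * (n + 1) + 4) +
          n * (8 * m * (p + 1) + 4))) : ℕ) : ENNReal) * e := by
        simp only [Finset.sum_const, Finset.card_univ, Fintype.card_fin, nsmul_eq_mul]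
        push_cast; ring
    _ ≤ ((300 * n ^ 5 : ℕ) : ENNReal) * e := by gcongr
    _ = _ := by
        rw [he, ENNReal.ofReal_mul (by positivity)]
        congr 1
        rw [← ENNReal.ofReal_natCast]
        push_cast; rfl

/-- For `c = y` the right-hand side is `(E - a) (b - E)`, with `a` and `b` the edges of the
Marchenko–Pastur law. -/
theorem le_discriminant {y c ε E : ℝ} (hy0 : 0 ≤ y) (hy1 : y ≤ 1) (hc0 : 0 ≤ c) (hc1 : c ≤ 1)
    (hc : |c - y| ≤ ε ^ 2 / 320) (hε : 0 < ε) (hEa : mpLeft y + ε / 2 ≤ E)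
    (hEb : E ≤ mpRight y - ε / 2) :
    ε ^ 2 / 8 ≤ 4 * c * E - (E + c - 1) ^ 2 := by
  unfold mpLeft at hEa
  unfold mpRight at hEb
  set r := √y with hr
  have hr2 : r ^ 2 = y := Real.sq_sqrt hy0
  have hr0 : 0 ≤ r := Real.sqrt_nonneg y
  have hr1 : r ≤ 1 := Real.sqrt_le_one.2 hy1
  have hE0 : 0 ≤ E := by nlinarith [sq_nonneg (1 - r)]
  have hE4 : E ≤ 4 := by nlinarith
  have h1 : ε / 2 * (ε / 2) ≤ (E - (1 - r) ^ 2) * ((1 + r) ^ 2 - E) :=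
    mul_le_mul (by linarith) (by linarith) (by linarith) (by linarith)
  have h2 : 4 * c * E - (E + c - 1) ^ 2 =
      (E - (1 - r) ^ 2) * ((1 + r) ^ 2 - E) + (c - y) * (2 * E + 2 - c - y) := by
    rw [← hr2]; ring
  have h3 : |(c - y) * (2 * E + 2 - c - y)| ≤ ε ^ 2 / 320 * 10 := by
    rw [abs_mul]
    refine mul_le_mul hc ?_ (abs_nonneg _) (by positivity)
    rw [abs_le]; constructor <;> linarith
  have h4 := (abs_le.1 h3).1
  rw [h2]
  nlinarith [sq_nonneg ε]

theorem isEigenvector_gram_of_isRightSingularVector {p n : ℕ} {M : Matrix (Fin p) (Fin n) ℂ}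
    {lam : ℝ} {u : EuclideanSpace ℂ (Fin n)} (h : IsRightSingularVector M lam u) :
    (((((√n)⁻¹ : ℝ) : ℂ) • M)ᴴ * ((((√n)⁻¹ : ℝ) : ℂ) • M)) *ᵥ u.ofLp = (lam : ℂ) • u.ofLp := by
  have h1 := h.apply_eq_smul
  have h2 := congrArg WithLp.ofLp h1
  have h3 : covMatrix M *ᵥ u.ofLp = (lam : ℂ) • u.ofLp := h2
  rw [← h3, covMatrix, Matrix.conjTranspose_smul, Matrix.smul_mul, Matrix.mul_smul, smul_smul,
    RCLike.star_def, Complex.conj_ofReal, ← Complex.ofReal_mul, ← mul_inv,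
    Real.mul_self_sqrt (Nat.cast_nonneg n)]
  simp

theorem isEigenvector_gram_of_isLeftSingularVector {p n : ℕ} {M : Matrix (Fin p) (Fin n) ℂ}
    {lam : ℝ} {v : EuclideanSpace ℂ (Fin p)} (h : IsLeftSingularVector M lam v) :
    (((((√n)⁻¹ : ℝ) : ℂ) • M)ᴴᴴ * ((((√n)⁻¹ : ℝ) : ℂ) • M)ᴴ) *ᵥ v.ofLp =
      (lam : ℂ) • v.ofLp := by
  have h1 := h.apply_eq_smul
  have h2 := congrArg WithLp.ofLp h1
  have h3 : covMatrixLeft M *ᵥ v.ofLp = (lam : ℂ) • v.ofLp := h2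
  rw [← h3, covMatrixLeft, Matrix.conjTranspose_conjTranspose, Matrix.conjTranspose_smul,
    Matrix.smul_mul, Matrix.mul_smul, smul_smul, RCLike.star_def, Complex.conj_ofReal,
    ← Complex.ofReal_mul, ← mul_inv, Real.mul_self_sqrt (Nat.cast_nonneg n)]
  simp

theorem IsLocallyRegular.singularVectorsBounded {p n k : ℕ} (hp : 0 < p) (hpn : p ≤ n)
    {M : Matrix (Fin p) (Fin n) ℂ} {y ε w σ R : ℝ} (hy0 : 0 < y) (hy1 : y ≤ 1) (hε : 0 < ε)
    (hc : |(p / n : ℝ) - y| ≤ ε ^ 2 / 320) (hc2 : y / 2 ≤ (p / n : ℝ)) (hn : 1 / (n : ℝ) ≤ ε / 2)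
    (hσ0 : 0 < σ) (hσ : σ ≤ y * min (1 / 52) (ε ^ 2 / 8 / 216) / 4) (hw0 : 0 ≤ w)
    (hw1 : 3 * w * (1 + 1 / σ) ≤ 1 / 2) (hw2 : 2 * (3 * w * (1 + 1 / σ)) ≤ ε ^ 2 / 8 / 40)
    (hk : 1 ≤ n * (1 / 2 : ℝ) ^ k)
    (hreg : IsLocallyRegular ((((√n)⁻¹ : ℝ) : ℂ) • M) (3 * w) k) (hR0 : 0 ≤ R)
    (hR : 8 * (1 / 2 : ℝ) ^ k / (σ * ε) ≤ R ^ 2) :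
    SingularVectorsBounded M (Set.Icc (mpLeft y + ε) (mpRight y - ε)) R := by
  rintro lam ⟨hla, hlb⟩
  have hnr : (0 : ℝ) < n := Nat.cast_pos.2 (hp.trans_le hpn)
  set η : ℝ := (1 / 2 : ℝ) ^ k with hη
  have hη0 : 0 < η := by positivity
  have ha0 : 0 ≤ mpLeft y := sq_nonneg _
  have hb4 : mpRight y ≤ 4 := by
    have h1 := Real.sqrt_le_one.2 hy1
    have h0 := Real.sqrt_nonneg y
    unfold mpRight; nlinarith
  -- the grid point just below the eigenvalue
  set l := ⌊lam * n⌋₊ with hl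
  have hlam0 : 0 ≤ lam := by linarith
  have hE1 : (l / n : ℝ) ≤ lam := by
    rw [div_le_iff₀ hnr]; exact Nat.floor_le (by positivity)
  have hE2 : lam - 1 / n ≤ (l / n : ℝ) := by
    rw [sub_le_iff_le_add, ← add_div, le_div_iff₀ hnr]
    exact (Nat.lt_floor_add_one (lam * n)).le
  set E : ℝ := (l / n : ℝ) with hE
  have hlt : l < 5 * n + 1 := by
    have : (l : ℝ) ≤ 5 * n := by
      have h1 : (l : ℝ) = E * n := by rw [hE]; field_simp
      rw [h1]
      exact mul_le_mul_of_nonneg_right (by linarith) hnr.le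
    exact Nat.lt_succ_of_le (by exact_mod_cast this)
  have hEε : ε / 2 ≤ E := by linarith
  have hEpos : 0 < E := by linarith
  have hnη : 1 / (n : ℝ) ≤ η := by rw [div_le_iff₀ hnr, mul_comm]; exact hk
  have hdist : (lam - E) ^ 2 ≤ η ^ 2 := by
    refine pow_le_pow_left₀ (by linarith) (by linarith) 2
  have hd := le_discriminant (E := E) hy0.le hy1 (by positivity)
    ((div_le_one hnr).2 (by exact_mod_cast hpn)) hc hε (by linarith) (by linarith)
  have hσ1 : σ ≤ (p / n : ℝ) * min (1 / 52) (ε ^ 2 / 8 / 216) / 2 := by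
    have h0 : 0 ≤ min (1 / 52 : ℝ) (ε ^ 2 / 8 / 216) := by positivity
    nlinarith
  obtain ⟨hL, hRt⟩ := norm_gramResolvent_diag_le_of_minorControl hp hpn hEpos.le (by linarith)
    (by positivity) hd hreg.frobenius hσ0 hσ1 (by positivity) hw1 hw2 k
    (fun j hj => hreg.row l hlt j hj) (hreg.col l hlt k le_rfl)
  -- an entry of a unit eigenvector is controlled by the diagonal resolvent entry
  have key : ∀ g x : ℝ, 0 ≤ g → E * g ≤ 2 / σ →
      x ^ 2 ≤ ((lam - E) ^ 2 + η ^ 2) / η * g → x ≤ R := by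
    intro g x hg hEg hx
    refine (abs_le_of_sq_le_sq' (hx.trans (le_trans ?_ hR)) hR0).2
    have h1 : g ≤ 4 / (σ * ε) := by
      rw [le_div_iff₀ (by positivity)]
      rw [le_div_iff₀ hσ0] at hEg
      nlinarith [mul_nonneg hg hσ0.le]
    have h2 : ((lam - E) ^ 2 + η ^ 2) / η ≤ 2 * η := by
      rw [div_le_iff₀ hη0]; nlinarith
    calc ((lam - E) ^ 2 + η ^ 2) / η * g ≤ 2 * η * (4 / (σ * ε)) := by gcongr
      _ = _ := by ring
  have hz : 0 < ((E : ℂ) + (η : ℝ) * Complex.I).im := by rwa [im_ofReal_add_mul_I]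
  refine ⟨fun u hu hue j => ?_, fun v hv hve i => ?_⟩
  · have hu1 : ∑ k, ‖u.ofLp k‖ ^ 2 = 1 := by
      rw [← EuclideanSpace.norm_sq_eq, hu, one_pow]
    have h := norm_sq_apply_le_of_eigenvector _ hz hu1
      (isEigenvector_gram_of_isRightSingularVector hue) j
    rw [im_ofReal_add_mul_I, re_ofReal_add_mul_I] at h
    exact key _ _ (norm_nonneg _) (hRt j) h
  · have hv1 : ∑ k, ‖v.ofLp k‖ ^ 2 = 1 := by
      rw [← EuclideanSpace.norm_sq_eq, hv, one_pow]
    have h := norm_sq_apply_le_of_eigenvector _ hz hv1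
      (isEigenvector_gram_of_isLeftSingularVector hve) i
    rw [im_ofReal_add_mul_I, re_ofReal_add_mul_I] at h
    exact key _ _ (norm_nonneg _) (hL i) h

/-! ### The choice of parameters -/

theorem ConditionC1.isBoundedStandard {Ω : Type*} [MeasurableSpace Ω] {P : Measure Ω} {p n : ℕ}
    {M : Ω → Matrix (Fin p) (Fin n) ℂ} {C₀ B K : ℝ} (h : ConditionC1 P M C₀ B)
    (hK : ∀ i j, ∀ᵐ ω ∂P, ‖M ω i j‖ ≤ K) :
    IsBoundedStandard P (fun (t : Fin p × Fin n) ω => M ω t.1 t.2) K where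
  measurable t := h.measurable t.1 t.2
  indep := h.indep
  bound t := hK t.1 t.2
  mean t := h.mean_zero t.1 t.2
  second t := by simpa [h.mean_zero] using h.variance_one t.1 t.2

/-- The estimate for one matrix size. The last scale `2⁻ᵏ` is comparable to `K² log¹⁸ n / n`, and
the deviation parameter is `log² n`. The concentration bound loses `log⁶ n`, so the relative error
is of order `log⁻³ n`; the remaining power `log² n` absorbs all constants. -/
theorem IsBoundedStandard.measure_compl_singularVectorsBounded_le {Ω : Type*}
    [MeasurableSpace Ω] {P : Measure Ω} [IsProbabilityMeasure P] {p n : ℕ} (hp : 0 < p)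
    (hpn : p ≤ n) {M : Ω → Matrix (Fin p) (Fin n) ℂ} {y ε σ K : ℝ}
    (hM : IsBoundedStandard P (fun (t : Fin p × Fin n) ω => M ω t.1 t.2) K) (hK : 1 ≤ K)
    (hy0 : 0 < y) (hy1 : y ≤ 1) (hε : 0 < ε)
    (hc : |(p / n : ℝ) - y| ≤ ε ^ 2 / 320) (hc2 : y / 2 ≤ (p / n : ℝ)) (hn : 1 / (n : ℝ) ≤ ε / 2)
    (hσ0 : 0 < σ) (hσ : σ ≤ y * min (1 / 52) (ε ^ 2 / 8 / 216) / 4)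
    (hl : 20 ≤ Real.log n) (hl1 : 6 * (1 + 1 / σ) ≤ Real.log n)
    (hl2 : 6 * (1 + 1 / σ) ≤ ε ^ 2 / 320 * Real.log n) (hl3 : 16 / (σ * ε) ≤ Real.log n) :
    P {ω | SingularVectorsBounded (M ω) (Set.Icc (mpLeft y + ε) (mpRight y - ε))
        (1 * K * (n : ℝ) ^ (-(1 / 2 : ℝ)) * Real.log n ^ 10)}ᶜ ≤
      ENNReal.ofReal (300 * (n : ℝ) ^ 5 * Real.exp (1 - Real.log n ^ 2)) := by
  have hn0 : 0 < n := hp.trans_le hpn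
  have hnr : (0 : ℝ) < n := Nat.cast_pos.2 hn0
  set ℓ := Real.log n with hℓ
  have hℓ0 : 0 < ℓ := by linarith
  have hK0 : 0 < K := by linarith
  have hsq : √(n : ℝ) ^ 2 = n := Real.sq_sqrt hnr.le
  have hsq0 : 0 < √(n : ℝ) := Real.sqrt_pos.2 hnr
  set R := 1 * K * (n : ℝ) ^ (-(1 / 2 : ℝ)) * ℓ ^ 10 with hRdef
  have hR : R = K * ℓ ^ 10 / √n := by
    rw [hRdef, Real.rpow_neg hnr.le, ← Real.sqrt_eq_rpow]
    ring
  have hR0 : 0 ≤ R := by rw [hR]; positivity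
  rcases le_or_gt 1 R with h1 | h1
  · -- a coordinate of a unit vector is at most one
    have : {ω | SingularVectorsBounded (M ω) (Set.Icc (mpLeft y + ε) (mpRight y - ε)) R}ᶜ =
        ∅ := by
      rw [Set.compl_empty_iff, Set.eq_univ_iff_forall]
      exact fun ω lam _ => ⟨fun u hu _ j => ((PiLp.norm_apply_le u j).trans hu.le).trans h1,
        fun v hv _ i => ((PiLp.norm_apply_le v i).trans hv.le).trans h1⟩
    rw [this, measure_empty]
    exact bot_le
  have hKn : K * ℓ ^ 10 ≤ √n := by
    rw [hR, div_lt_one hsq0] at h1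
    exact h1.le
  have hKn2 : K ^ 2 * ℓ ^ 20 ≤ n := by
    calc K ^ 2 * ℓ ^ 20 = (K * ℓ ^ 10) ^ 2 := by ring
      _ ≤ √n ^ 2 := pow_le_pow_left₀ (by positivity) hKn 2
      _ = n := hsq
  have hℓ1 : 1 ≤ ℓ := by linarith
  set Q := K ^ 2 * ℓ ^ 18 with hQ
  have hQ1 : 1 ≤ Q := one_le_mul_of_one_le_of_one_le (one_le_pow₀ hK) (one_le_pow₀ hℓ1)
  have hQn : Q / n ≤ 1 := by
    rw [div_le_one hnr]
    refine le_trans ?_ hKn2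
    rw [hQ]
    exact mul_le_mul_of_nonneg_left (pow_le_pow_right₀ hℓ1 (by norm_num)) (sq_nonneg _)
  -- `2⁻ᵏ` is the last dyadic scale above `Q / n`
  obtain ⟨k, hk1, hk2⟩ := exists_nat_pow_near_of_lt_one (x := Q / n) (y := (1 / 2 : ℝ))
    (by positivity) hQn (by norm_num) (by norm_num)
  have hkQ : Q ≤ n * (1 / 2 : ℝ) ^ k := by
    rw [div_le_iff₀ hnr] at hk2; linarith
  have hkn : k < n := by
    have h2 : ((2 : ℝ) ^ k) ≤ n := by
      have h3 := hQ1.trans hkQ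
      rw [one_div, inv_pow, ← div_eq_mul_inv, le_div_iff₀ (by positivity), one_mul] at h3
      exact h3
    exact (Nat.lt_two_pow_self).trans_le (by exact_mod_cast h2)
  set m := Nat.log 2 n + 1 with hm
  have hnm : n ≤ 2 ^ m := (Nat.lt_pow_succ_log_self (by norm_num) n).le
  have hmn : m ≤ n := Nat.log_lt_self 2 hn0.ne'
  have hmℓ : 8 * (m : ℝ) + 2 ≤ ℓ ^ 2 := by
    have h2 : ((2 : ℝ) ^ Nat.log 2 n) ≤ n := by exact_mod_cast Nat.pow_log_le_self 2 hn0.ne'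
    have h3 := Real.log_le_log (by positivity) h2
    rw [Real.log_pow] at h3
    have h4 := Real.log_two_gt_d9
    have h5 : (0 : ℝ) ≤ Nat.log 2 n := Nat.cast_nonneg _
    have h6 : (Nat.log 2 n : ℝ) * 0.69 ≤ ℓ :=
      (mul_le_mul_of_nonneg_left (by linarith) h5).trans h3
    rw [hm]
    push_cast
    nlinarith
  have hℓ3 : (1 / ℓ) ^ 3 ≤ 1 / ℓ :=
    pow_le_of_le_one (by positivity) ((div_le_one hℓ0).2 hℓ1) (by norm_num)
  have hw : ∀ δ, 6 * (1 + 1 / σ) ≤ δ * ℓ → 2 * (3 * (1 / ℓ) ^ 3 * (1 + 1 / σ)) ≤ δ := by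
    intro δ hδ
    calc 2 * (3 * (1 / ℓ) ^ 3 * (1 + 1 / σ)) ≤ 2 * (3 * (1 / ℓ) * (1 + 1 / σ)) := by gcongr
      _ = 6 * (1 + 1 / σ) / ℓ := by ring
      _ ≤ δ := by rwa [div_le_iff₀ hℓ0]
  have hgood := hM.measure_not_isLocallyRegular_le (m := m) (k := k) (L := ℓ ^ 2)
    (w := (1 / ℓ) ^ 3) hn0 hpn hnm hmn hkn hK (one_le_pow₀ hℓ1) (hQ1.trans hkQ) (by positivity)
    (pow_le_one₀ (by positivity) ((div_le_one hℓ0).2 hℓ1)) ?_ ?_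
  · refine (measure_mono fun ω hω => ?_).trans hgood
    refine fun hreg => hω (hreg.singularVectorsBounded hp hpn hy0 hy1 hε hc hc2 hn hσ0 hσ
      (by positivity) ?_ ?_ (hQ1.trans hkQ) hR0 ?_)
    · have := hw 1 (by linarith)
      linarith
    · refine hw _ (hl2.trans_eq ?_)
      ring
    · have h2 : (1 / 2 : ℝ) ^ k ≤ 2 * (Q / n) := by
        rw [pow_succ] at hk1; linarith
      calc 8 * (1 / 2 : ℝ) ^ k / (σ * ε) ≤ 8 * (2 * (Q / n)) / (σ * ε) := by gcongr
        _ = 16 / (σ * ε) * (Q / n) := by ring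
        _ ≤ ℓ ^ 2 * (Q / n) := by
            gcongr
            exact hl3.trans (le_self_pow₀ hℓ1 (by norm_num))
        _ = R ^ 2 := by
            rw [hR, div_pow, hsq, hQ]; ring
  · calc ((8 * (m : ℝ) + 2) * (ℓ ^ 2) ^ 2) ^ 2 * K ^ 2 ≤ (ℓ ^ 2 * (ℓ ^ 2) ^ 2) ^ 2 * K ^ 2 := by
          gcongr
      _ = ((1 / ℓ) ^ 3) ^ 2 * Q := by
          rw [hQ]; field_simp
      _ ≤ _ := by gcongr
  · have h2 : K ≤ √n := by
      refine le_trans ?_ hKn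
      exact le_mul_of_one_le_right hK0.le (one_le_pow₀ hℓ1)
    have h4 : 4 ≤ ℓ ^ 8 := by
      have : ℓ ≤ ℓ ^ 8 := le_self_pow₀ hℓ1 (by norm_num)
      linarith
    calc 2 * ℓ ^ 2 * (K * √n + K ^ 2) ≤ 2 * ℓ ^ 2 * (K * √n + K * √n) := by
          gcongr
          rw [pow_two]; gcongr
      _ = 4 * (ℓ ^ 2 * K * √n) := by ring
      _ ≤ ℓ ^ 8 * (ℓ ^ 2 * K * √n) := by gcongr
      _ = K * ℓ ^ 10 * √n := by ring
      _ ≤ √n * √n := by gcongr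
      _ = n := Real.mul_self_sqrt hnr.le

theorem theorem3p1 (y : ℝ) (hy0 : 0 < y) (hy1 : y ≤ 1) (ε : ℝ) (hε : 0 < ε) :
    ∃ C : ℝ, 0 < C ∧
      ∀ (p : ℕ → ℕ) (K : ℕ → ℝ) (C₀ B : ℝ)
        (Ω : ℕ → Type*) [∀ n, MeasurableSpace (Ω n)]
        (P : ∀ n, Measure (Ω n)) [∀ n, IsProbabilityMeasure (P n)]
        (M : ∀ n, Ω n → Matrix (Fin (p n)) (Fin n) ℂ),
        (∀ᶠ n in atTop, p n ≤ n) →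
        Tendsto (fun n : ℕ => (p n : ℝ) / (n : ℝ)) atTop (𝓝 y) →
        2 ≤ C₀ →
        (∀ᶠ n in atTop, ConditionC1 (P n) (M n) C₀ B) →
        (∀ᶠ n in atTop, 1 < K n) →
        (∀ᶠ n in atTop, ∀ i j, ∀ᵐ ω ∂(P n), ‖M n ω i j‖ ≤ K n) →
        (∀ᶠ n in atTop, HasContinuousLaw (P n) (M n)) →
        WithOverwhelmingProbability P (fun n =>
          {ω | SingularVectorsBounded (M n ω) (Set.Icc (mpLeft y + ε) (mpRight y - ε))
            (C * K n * (n : ℝ) ^ (-(1 / 2 : ℝ)) * Real.log n ^ 10)}) := by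
  refine ⟨1, one_pos, ?_⟩
  intro p K C₀ B Ω _ P _ M hpn hlim _ hC1 hK hb _ A _
  refine ⟨300 * Real.exp 1, ?_⟩
  set σ : ℝ := y * min (1 / 52) (ε ^ 2 / 8 / 216) / 4 with hσ
  have hσ0 : 0 < σ := by positivity
  have hlog : Tendsto (fun n : ℕ => Real.log n) atTop atTop :=
    Real.tendsto_log_atTop.comp tendsto_natCast_atTop_atTop
  have hc := Metric.tendsto_nhds.1 hlim (min (ε ^ 2 / 320) (y / 2)) (by positivity)
  have hinv : ∀ᶠ n : ℕ in atTop, 1 / (n : ℝ) ≤ ε / 2 :=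
    (tendsto_one_div_atTop_nhds_zero_nat (𝕜 := ℝ)).eventually_le_const (by positivity)
  filter_upwards [hpn, hC1, hK, hb, hc, hinv, eventually_gt_atTop 0,
    hlog.eventually_ge_atTop 20, hlog.eventually_ge_atTop (6 * (1 + 1 / σ)),
    hlog.eventually_ge_atTop (6 * (1 + 1 / σ) / (ε ^ 2 / 320)),
    hlog.eventually_ge_atTop (16 / (σ * ε)), hlog.eventually_ge_atTop (A + 5)]
    with n hpn hC1 hK hb hc hinv hn0 hl hl1 hl2 hl3 hlA
  have hnr : (0 : ℝ) < n := Nat.cast_pos.2 hn0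
  rw [Real.dist_eq, lt_min_iff] at hc
  have hc2 : y / 2 ≤ (p n : ℝ) / n := by linarith [(abs_lt.1 hc.2).1]
  have hp : 0 < p n := by
    rcases Nat.eq_zero_or_pos (p n) with h | h
    · rw [h] at hc2; simp at hc2; linarith
    · exact h
  refine ((hC1.isBoundedStandard hb).measure_compl_singularVectorsBounded_le hp hpn hK.le hy0 hy1
    hε hc.1.le hc2 hinv hσ0 le_rfl hl hl1 ?_ hl3).trans (ENNReal.ofReal_le_ofReal ?_)
  · rw [div_le_iff₀ (by positivity)] at hl2; linarith
  · have h1 : (n : ℝ) ^ 5 = Real.exp (5 * Real.log n) := by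
      rw [mul_comm, Real.exp_mul, Real.exp_log hnr]; norm_cast
    have h2 : (n : ℝ) ^ (-A) = Real.exp (-A * Real.log n) := by
      rw [Real.rpow_def_of_pos hnr, mul_comm]
    rw [h1, h2, mul_assoc, mul_assoc, ← Real.exp_add, ← Real.exp_add]
    refine mul_le_mul_of_nonneg_left (Real.exp_le_exp.2 ?_) (by norm_num)
    nlinarith
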